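/- Let $\Delta$ be a random vector of $\mathbb R^d$ having exponential moments in a neighbourhood of $0$: there is $r>0$ such that $\mathbb E[e^{\langle\theta,\Delta\rangle}]<\infty$ for every $\theta\in\mathbb R^d$ with $|\theta|\le r$. Let $m$ be the mean of $\Delta$ (a row vector) and $\Sigma^2$ its covariance matrix, and for every $x\in\mathbb R^d$ let $\mathcal R_x$ be the law of $x+\Delta$. Let $\mathcal M_0$ be any finite Borel measure on $\mathbb R^d$ with $0<\mathcal M_0(\mathbb R^d)<\infty$, and let $(\mathcal M_n)_{n\ge 0}$ be the measure-valued Pólya process with initial composition $\mathcal M_0$ and replacement measures $(\mathcal R_x)_{x\in\mathbb R^d}$: for every $n\ge 0$, conditionally on the past up to time $n$, a random colour $C_n$ is drawn under the probability measure $\mathcal M_n/\mathcal M_n(\mathbb R^d)$, and $\mathcal M_{n+1}=\mathcal M_n+\mathcal R_{C_n}$. For a scalar $a$, a vector $b$ and a measure $\mu$, let $\Theta_{a,b}(\mu)$ be the image of $\mu$ under $x\mapsto a^{-1}(x-b)$. Then, almost surely, as $n\to\infty$, $$\Theta_{\sqrt{\log n},\,m\log n}\left(n^{-1}\mathcal M_n\right)\longrightarrow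 \mathcal N\left(0,\,\Sigma^2+m^Tm\right)$$ weakly, where $m^Tm$ is the $d\times d$ matrix with entries $m_im_j$. -/

import Mathlib

open MeasureTheory ProbabilityTheory Filter Topology
open scoped NNReal ENNReal

noncomputable section

/-- `nor ν` is the probability measure proportional to the (nonzero, finite) measure `ν`. -/
def nor {P : Type*} [MeasurableSpace P] (ν : Measure P) : Measure P :=
  (ν Set.univ)⁻¹ • ν

/-- `M = (M n)` is a measure-valued Pólya process on the colour space `P` with initial composition
`M₀` and replacement measures `R x`, `x : P`: there are random colours `C n` such that,
conditionally on the past up to time `n`, the colour `C n` has law `nor (M n)`, and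
`M (n + 1) = M n + R (C n)`.

The past up to time `n` is given by a filtration `ℱ`: the colours drawn before time `n`
(and hence `M n`) are `ℱ n`-measurable. One may take the filtration generated by the colours. -/
def IsMVPP {P : Type*} [MeasurableSpace P] {Ω : Type*} {mΩ : MeasurableSpace Ω}
    (μ : Measure Ω) (M₀ : FiniteMeasure P) (R : Kernel P P)
    (M : ℕ → Ω → FiniteMeasure P) : Prop :=
  ∃ (ℱ : Filtration ℕ mΩ) (C : ℕ → Ω → P),
    (∀ n, Measurable[ℱ (n + 1)] (C n)) ∧
    (∀ ω, M 0 ω = M₀) ∧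
    (∀ n ω, (M (n + 1) ω : Measure P) = (M n ω : Measure P) + R (C n ω)) ∧
    (∀ n (B : Set P), MeasurableSet B →
      μ⟦C n ⁻¹' B | ℱ n⟧ =ᵐ[μ] fun ω => (nor (M n ω : Measure P)).real B)

/-- `rescale a b ν` is the image of the measure `ν` under `x ↦ a⁻¹ (x - b)`. -/
def rescale {E : Type*} [AddCommGroup E] [Module ℝ E] [MeasurableSpace E]
    (a : ℝ) (b : E) (ν : FiniteMeasure E) : FiniteMeasure E :=
  ν.map (fun x => a⁻¹ • (x - b))

/-- The covariance matrix of a random vector `X` of `ℝ^d`. -/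
def covMat {d : ℕ} {Ω : Type*} [MeasurableSpace Ω] (X : Ω → EuclideanSpace ℝ (Fin d))
    (ν : Measure Ω) : Matrix (Fin d) (Fin d) ℝ :=
  Matrix.of fun i j => cov[fun ω => X ω i, fun ω => X ω j; ν]

/-- The matrix `(x_i x_j)_{i,j}`, that is `xᵀ x` for the row vector `x`. -/
def outerSq {d : ℕ} (x : EuclideanSpace ℝ (Fin d)) : Matrix (Fin d) (Fin d) ℝ :=
  Matrix.of fun i j => x i * x j

/-- The Gaussian law `N(b, S)` on `ℝ^d` as a finite measure. -/
def gaussianLaw {d : ℕ} (b : EuclideanSpace ℝ (Fin d)) (S : Matrix (Fin d) (Fin d) ℝ) :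
    FiniteMeasure (EuclideanSpace ℝ (Fin d)) :=
  ⟨multivariateGaussian b S, inferInstance⟩

end

/-! Write `c` for the initial mass, `w` for the characteristic function of `Δ`, and `Y_n(s)` for the
Fourier transform of `M n` divided by its mass `n + c`. Since `R x` is a translate, a drawn colour
`x` adds `e^{i⟨x,s⟩} w(s)` to the Fourier transform. Given the past, `e^{i⟨C_n,s⟩}` has mean
`Y_n(s)`, so `E[Y_{n+1}(s) | ℱ n] = (n + c + w(s)) / (n + 1 + c) · Y_n(s)`. The product of these
factors from `N` to `n` (`meanFactor`) behaves like `n^{w(s) - 1}` when `s` is small and `N` is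
polylogarithmic (`tendsto_meanFactor_mul_exp`). At `s = θ / √(log n)`, a second order expansion
gives `log n · (w(s) - 1) = i log n ⟨m, s⟩ - E⟨Δ, θ⟩² / 2 + o(1)`. The first term is the centring by
`m log n`, and the second is the Gaussian exponent, whose covariance is the uncentred second moment
matrix `Σ² + mᵀm`.

It remains to replace `Y_n(s)` by its conditional mean given the time `N = ⌈log n⌉⁴` (`logTime`).
From `N` on, the martingale increments at step `k` are `O(1/k)`, so an Azuma bound makes a deviation
by `ε` exponentially unlikely in `(log n)²`. This beats the polynomial number of points of a lattice
of mesh `1 / (n + 1)`, and Borel–Cantelli gives one null set valid for all frequencies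
(`ae_eventually_lattice`).

Two comparisons remain: `Y_n` at a frequency with `Y_n` at a nearby lattice point, and `Y_N` at a
small frequency with `Y_N(0) = 1`. Both follow from the normalised composition putting
asymptotically no mass at distance `(n + 1)^{1/8}` (`ae_tendsto_truncMean`), which is a
supermartingale argument with summable drift. Lévy's theorem concludes. -/

/-- The data of a measure-valued Pólya process: the filtration `ℱ` and the drawn colours `C`. -/
structure IsPolyaScheme {P : Type*} [MeasurableSpace P] {Ω : Type*} {mΩ : MeasurableSpace Ω}
    (μ : Measure Ω) (M₀ : FiniteMeasure P) (R : Kernel P P) (M : ℕ → Ω → FiniteMeasure P)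
    (ℱ : Filtration ℕ mΩ) (C : ℕ → Ω → P) : Prop where
  measurable_color : ∀ n, Measurable[ℱ (n + 1)] (C n)
  zero : ∀ ω, M 0 ω = M₀
  succ : ∀ n ω, (M (n + 1) ω : Measure P) = (M n ω : Measure P) + R (C n ω)
  condLaw : ∀ n (B : Set P), MeasurableSet B →
    μ⟦C n ⁻¹' B | ℱ n⟧ =ᵐ[μ] fun ω => (nor (M n ω : Measure P)).real B

/-! ### Total mass, measurability and conditional law of the drawn colours. -/

namespace IsPolyaScheme

variable {P : Type*} [MeasurableSpace P] {Ω : Type*} {mΩ : MeasurableSpace Ω}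
  {μ : Measure Ω} {M₀ : FiniteMeasure P} {R : Kernel P P} {M : ℕ → Ω → FiniteMeasure P}
  {ℱ : Filtration ℕ mΩ} {C : ℕ → Ω → P}

lemma measurable_color' (h : IsPolyaScheme μ M₀ R M ℱ C) (n : ℕ) : Measurable (C n) :=
  (h.measurable_color n).mono (ℱ.le _) le_rfl

lemma measurable_measure (h : IsPolyaScheme μ M₀ R M ℱ C) (n : ℕ) :
    Measurable fun ω => (M n ω : Measure P) := by
  induction n with
  | zero => simp only [h.zero]; exact measurable_const
  | succ n ih =>
    simp only [h.succ]
    refine Measure.measurable_of_measurable_coe _ fun s hs => ?_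
    simp only [Measure.add_apply]
    exact ((Measure.measurable_coe hs).comp ih).add
      ((R.measurable_coe hs).comp (h.measurable_color' n))

lemma univ_eq [IsMarkovKernel R] (h : IsPolyaScheme μ M₀ R M ℱ C) (n : ℕ) (ω : Ω) :
    (M n ω : Measure P) Set.univ = (M₀ : Measure P) Set.univ + n := by
  induction n with
  | zero => simp [h.zero]
  | succ n ih => simp [h.succ, ih, add_assoc]

lemma real_univ_eq [IsMarkovKernel R] (h : IsPolyaScheme μ M₀ R M ℱ C) (n : ℕ) (ω : Ω) :
    (M n ω : Measure P).real Set.univ = n + M₀.mass := by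
  rw [measureReal_def, h.univ_eq, ENNReal.toReal_add (measure_ne_top _ _) (by simp), add_comm]
  simp [FiniteMeasure.mass]
  rfl

section integral

variable {E : Type*} [NormedAddCommGroup E] [NormedSpace ℝ E]

lemma integral_succ [IsMarkovKernel R] (h : IsPolyaScheme μ M₀ R M ℱ C) {f : P → E}
    (hf : StronglyMeasurable f) {B : ℝ} (hB : ∀ x, ‖f x‖ ≤ B) (n : ℕ) (ω : Ω) :
    ∫ x, f x ∂(M (n + 1) ω : Measure P)
      = ∫ x, f x ∂(M n ω : Measure P) + ∫ x, f x ∂(R (C n ω)) := by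
  rw [h.succ, integral_add_measure]
  · exact .of_bound hf.aestronglyMeasurable B (ae_of_all _ hB)
  · exact .of_bound hf.aestronglyMeasurable B (ae_of_all _ hB)

lemma stronglyMeasurable_integral [IsMarkovKernel R] (h : IsPolyaScheme μ M₀ R M ℱ C) {f : P → E}
    (hf : StronglyMeasurable f) {B : ℝ} (hB : ∀ x, ‖f x‖ ≤ B) (n : ℕ) :
    StronglyMeasurable[ℱ n] fun ω => ∫ x, f x ∂(M n ω : Measure P) := by
  induction n with
  | zero => simp only [h.zero]; exact stronglyMeasurable_const
  | succ n ih =>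
    simp only [h.integral_succ hf hB]
    exact (ih.mono (ℱ.mono n.le_succ)).add
      ((hf.integral_kernel (κ := R)).comp_measurable (h.measurable_color n))

end integral

lemma norm_integral_le {E : Type*} [NormedAddCommGroup E] [NormedSpace ℝ E] [IsMarkovKernel R]
    (h : IsPolyaScheme μ M₀ R M ℱ C) {f : P → E} {B : ℝ} (hB : ∀ x, ‖f x‖ ≤ B) (n : ℕ) (ω : Ω) :
    ‖∫ x, f x ∂(M n ω : Measure P)‖ ≤ B * (n + M₀.mass) := by
  rw [← h.real_univ_eq n ω]
  exact norm_integral_le_of_norm_le_const (ae_of_all _ hB)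

/-- The conditional law of the `n`-th colour, as a kernel. -/
noncomputable def colorKernel (h : IsPolyaScheme μ M₀ R M ℱ C) (n : ℕ) : Kernel Ω P where
  toFun ω := nor (M n ω : Measure P)
  measurable' := by
    refine Measure.measurable_of_measurable_coe _ fun s hs => ?_
    simp only [nor, Measure.smul_apply, smul_eq_mul]
    have := h.measurable_measure n
    exact ((Measure.measurable_coe MeasurableSet.univ).comp this).inv.mul
      ((Measure.measurable_coe hs).comp this)

lemma isMarkovKernel_colorKernel [IsMarkovKernel R] (h : IsPolyaScheme μ M₀ R M ℱ C)
    (hM₀ : 0 < M₀.mass) (n : ℕ) : IsMarkovKernel (h.colorKernel n) where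
  isProbabilityMeasure ω := ⟨by
    have h0 : (M n ω : Measure P) Set.univ ≠ 0 := by
      rw [h.univ_eq]
      have : (M₀ : Measure P) Set.univ ≠ 0 := by
        rw [← FiniteMeasure.ennreal_mass]; exact_mod_cast hM₀.ne'
      simp [this]
    change nor (M n ω : Measure P) Set.univ = 1
    simp only [nor, Measure.smul_apply, smul_eq_mul]
    exact ENNReal.inv_mul_cancel h0 (measure_ne_top _ _)⟩

lemma integral_colorKernel {E : Type*} [NormedAddCommGroup E] [NormedSpace ℝ E] [IsMarkovKernel R]
    (h : IsPolyaScheme μ M₀ R M ℱ C) (n : ℕ) (ω : Ω) (f : P → E) :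
    ∫ x, f x ∂(h.colorKernel n ω) = ((n : ℝ) + M₀.mass)⁻¹ • ∫ x, f x ∂(M n ω : Measure P) := by
  change ∫ x, f x ∂(nor (M n ω : Measure P)) = _
  rw [nor, integral_smul_measure, ENNReal.toReal_inv, ← measureReal_def, h.real_univ_eq]

/-- The conditional law is known set by set; integrating it over a past event `A` gives an equality
of measures on `P`, which can then be tested against any bounded measurable function without
approximation by simple functions. -/
lemma map_color_restrict [IsProbabilityMeasure μ] [IsMarkovKernel R]
    (h : IsPolyaScheme μ M₀ R M ℱ C) (hM₀ : 0 < M₀.mass) (n : ℕ) {A : Set Ω}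
    (hA : MeasurableSet[ℱ n] A) :
    (μ.restrict A).map (C n) = (μ.restrict A).bind (h.colorKernel n) := by
  have := h.isMarkovKernel_colorKernel hM₀ n
  ext B hB
  have hCB := h.measurable_color' n hB
  rw [Measure.map_apply (h.measurable_color' n) hB,
    Measure.bind_apply hB (h.colorKernel n).measurable.aemeasurable,
    ← ENNReal.toReal_eq_toReal_iff' (measure_ne_top _ _) ?_]
  swap
  · refine ne_top_of_le_ne_top (measure_ne_top (μ.restrict A) Set.univ) ?_
    calc _ ≤ ∫⁻ _, 1 ∂(μ.restrict A) := lintegral_mono fun ω => prob_le_one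
      _ = _ := by simp
  rw [← integral_toReal ((h.colorKernel n).measurable_coe hB).aemeasurable
    (ae_of_all _ fun ω => measure_lt_top _ _), ← measureReal_def]
  have h1 : ∫ ω in A, (C n ⁻¹' B).indicator (fun _ => (1 : ℝ)) ω ∂μ
      = ∫ ω in A, (nor (M n ω : Measure P)).real B ∂μ := by
    rw [← setIntegral_condExp (ℱ.le n) ((integrable_const _).indicator hCB) hA]
    exact integral_congr_ae (ae_restrict_of_ae (h.condLaw n B hB))
  rw [integral_indicator hCB] at h1
  simp only [setIntegral_const, smul_eq_mul, mul_one] at h1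
  exact h1

/-- Conditionally on the past, the `n`-th colour has law `M n / (n + M₀.mass)`. -/
lemma condExp_color [IsProbabilityMeasure μ] [IsMarkovKernel R]
    (h : IsPolyaScheme μ M₀ R M ℱ C) (hM₀ : 0 < M₀.mass) (n : ℕ) {f : P → ℝ}
    (hf : Measurable f) {B : ℝ} (hB : ∀ x, ‖f x‖ ≤ B) :
    μ[fun ω => f (C n ω) | ℱ n] =ᵐ[μ]
      fun ω => ((n : ℝ) + M₀.mass)⁻¹ * ∫ x, f x ∂(M n ω : Measure P) := by
  have := h.isMarkovKernel_colorKernel hM₀ n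
  have hmeas : StronglyMeasurable[ℱ n]
      fun ω => ((n : ℝ) + M₀.mass)⁻¹ * ∫ x, f x ∂(M n ω : Measure P) :=
    (h.stronglyMeasurable_integral hf.stronglyMeasurable hB n).const_mul _
  have hc : (0 : ℝ) < n + M₀.mass := by positivity
  symm
  refine ae_eq_condExp_of_forall_setIntegral_eq (ℱ.le n)
    (.of_bound (hf.comp (h.measurable_color' n)).aestronglyMeasurable B
      (ae_of_all _ fun ω => hB _)) (fun s hs _ => ?_) (fun s hs _ => ?_)
    hmeas.aestronglyMeasurable
  · refine (Integrable.of_bound (hmeas.mono (ℱ.le n)).aestronglyMeasurable B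
      (ae_of_all _ fun ω => ?_)).integrableOn
    rw [norm_mul, norm_inv, Real.norm_of_nonneg hc.le, inv_mul_le_iff₀ hc, mul_comm]
    exact h.norm_integral_le hB n ω
  · have key := h.map_color_restrict hM₀ n hs
    have h1 : ∫ ω in s, f (C n ω) ∂μ = ∫ x, f x ∂((μ.restrict s).map (C n)) :=
      (integral_map (h.measurable_color' n).aemeasurable hf.aestronglyMeasurable).symm
    have h2 : ∫ x, f x ∂((μ.restrict s).bind (h.colorKernel n))
        = ∫ ω in s, ∫ x, f x ∂(h.colorKernel n ω) ∂μ := by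
      have := Kernel.integral_comp (κ := Kernel.const Unit (μ.restrict s)) (η := h.colorKernel n)
        (a := ()) (f := f) (.of_bound hf.aestronglyMeasurable B (ae_of_all _ hB))
      simpa only [Kernel.comp_apply, Kernel.const_apply] using this
    rw [h1, key, h2]
    simp only [h.integral_colorKernel, smul_eq_mul]

end IsPolyaScheme

/-! ### Exponential moments of martingales and the mean growth factor. -/

lemma Real.exp_le_one_add_add_sq {x : ℝ} (hx : |x| ≤ 1) : Real.exp x ≤ 1 + x + x ^ 2 := by
  have := (abs_le.1 (Real.abs_exp_sub_one_sub_id_le hx)).2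
  linarith

/-- Exponential moments of martingales with bounded increments (Azuma–Hoeffding). -/
lemma integral_exp_sub_le_of_bounded_increments {Ω : Type*} {mΩ : MeasurableSpace Ω}
    {μ : Measure Ω} [IsProbabilityMeasure μ] {ℱ : Filtration ℕ mΩ} {X : ℕ → Ω → ℝ} {v : ℕ → ℝ}
    {N n : ℕ} (hNn : N ≤ n)
    (hX : ∀ k, N ≤ k → StronglyMeasurable[ℱ k] (X k))
    (hv : ∀ k, N ≤ k → k < n → ∀ ω, |X (k + 1) ω - X k ω| ≤ v k)
    (hv1 : ∀ k, N ≤ k → k < n → v k ≤ 1)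
    (hcond : ∀ k, N ≤ k → k < n → μ[X (k + 1) - X k | ℱ k] =ᵐ[μ] 0) :
    ∫ ω, Real.exp (X n ω - X N ω) ∂μ ≤ Real.exp (∑ k ∈ Finset.Ico N n, v k ^ 2) := by
  -- This deterministic bound only serves the integrability of the exponentials.
  have hb : ∀ j, N ≤ j → j ≤ n → ∀ ω, |X j ω - X N ω| ≤ ∑ k ∈ Finset.Ico N j, v k := by
    intro j hj
    induction j, hj using Nat.le_induction with
    | base => simp
    | succ j hj ih =>
      intro hjn ω
      rw [Finset.sum_Ico_succ_top hj]
      have h1 := ih (by omega) ω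
      have h2 := hv j hj (by omega) ω
      calc |X (j + 1) ω - X N ω| = |(X j ω - X N ω) + (X (j + 1) ω - X j ω)| := by ring_nf
        _ ≤ _ := (abs_add_le _ _).trans (add_le_add h1 h2)
  suffices ∀ j, N ≤ j → j ≤ n →
      ∫ ω, Real.exp (X j ω - X N ω) ∂μ ≤ Real.exp (∑ k ∈ Finset.Ico N j, v k ^ 2) from
    this n hNn le_rfl
  intro j hj
  induction j, hj using Nat.le_induction with
  | base => simp
  | succ j hj ih =>
    intro hjn
    have ih := ih (by omega)
    have hvj := hv j hj (by omega)
    have hv1j := hv1 j hj (by omega)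
    have hD : StronglyMeasurable[ℱ j] fun ω => Real.exp (X j ω - X N ω) :=
      Real.continuous_exp.comp_stronglyMeasurable
        ((hX j hj).sub ((hX N le_rfl).mono (ℱ.mono hj)))
    have hDb : ∀ ω, ‖Real.exp (X j ω - X N ω)‖ ≤ Real.exp (∑ k ∈ Finset.Ico N j, v k) := by
      intro ω
      rw [Real.norm_of_nonneg (Real.exp_pos _).le, Real.exp_le_exp]
      exact (le_abs_self _).trans (hb j hj (by omega) ω)
    have hξ : StronglyMeasurable (X (j + 1) - X j) :=
      ((hX (j + 1) (by omega)).mono (ℱ.le _)).sub ((hX j hj).mono (ℱ.le _))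
    have hDi : Integrable (fun ω => Real.exp (X j ω - X N ω)) μ :=
      .of_bound (hD.mono (ℱ.le _)).aestronglyMeasurable _ (ae_of_all _ hDb)
    have hξi : Integrable (X (j + 1) - X j) μ :=
      .of_bound hξ.aestronglyMeasurable _ (ae_of_all _ hvj)
    have hDξ : Integrable ((fun ω => Real.exp (X j ω - X N ω)) * (X (j + 1) - X j)) μ :=
      hξi.bdd_mul (hD.mono (ℱ.le _)).aestronglyMeasurable (ae_of_all _ hDb)
    have hzero : ∫ ω, ((fun ω => Real.exp (X j ω - X N ω)) * (X (j + 1) - X j)) ω ∂μ = 0 := by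
      rw [← integral_condExp (ℱ.le j)]
      have h1 := condExp_mul_of_stronglyMeasurable_left hD hDξ hξi
      rw [integral_congr_ae (g := fun _ => 0), integral_zero]
      filter_upwards [h1, hcond j hj (by omega)] with ω h1 h2
      rw [h1, Pi.mul_apply, h2, Pi.zero_apply, mul_zero]
    -- The increment `ξ` satisfies `e^ξ ≤ 1 + ξ + ξ²` because `|ξ| ≤ v j ≤ 1`; its linear term
    -- integrates to zero against the past.
    calc ∫ ω, Real.exp (X (j + 1) ω - X N ω) ∂μ
        ≤ ∫ ω, ((1 + v j ^ 2) * Real.exp (X j ω - X N ω)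
            + ((fun ω => Real.exp (X j ω - X N ω)) * (X (j + 1) - X j)) ω) ∂μ := by
          refine integral_mono_of_nonneg (ae_of_all _ fun ω => (Real.exp_pos _).le)
            ((hDi.const_mul _).add hDξ) (ae_of_all _ fun ω => ?_)
          have h1 := Real.exp_le_one_add_add_sq ((hvj ω).trans hv1j)
          have h2 : (X (j + 1) ω - X j ω) ^ 2 ≤ v j ^ 2 := sq_le_sq' (abs_le.1 (hvj ω)).1
            (abs_le.1 (hvj ω)).2
          have h3 := Real.exp_pos (X j ω - X N ω)
          have h4 : X (j + 1) ω - X N ω = (X j ω - X N ω) + (X (j + 1) ω - X j ω) := by ring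
          simp only [Pi.mul_apply, Pi.sub_apply]
          rw [h4, Real.exp_add]
          nlinarith
      _ = (1 + v j ^ 2) * ∫ ω, Real.exp (X j ω - X N ω) ∂μ := by
          rw [integral_add (hDi.const_mul _) hDξ, hzero, add_zero, integral_const_mul]
      _ ≤ Real.exp (v j ^ 2) * Real.exp (∑ k ∈ Finset.Ico N j, v k ^ 2) := by
          gcongr
          linarith [Real.add_one_le_exp (v j ^ 2)]
      _ = _ := by rw [← Real.exp_add, Finset.sum_Ico_succ_top hj, add_comm]

/-- The factor by which the mean of the normalised Fourier transform of a Pólya process with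
increments of characteristic function `w` is multiplied between times `N` and `n`. -/
noncomputable def meanFactor (c : ℝ) (w : ℂ) (N n : ℕ) : ℂ :=
  ∏ k ∈ Finset.Ico N n, (((k + c : ℝ) : ℂ) + w) / ((k + 1 + c : ℝ) : ℂ)

/-- Each factor has modulus at most `(k + c + 1) / (k + 1 + c) = 1`. Hence rescaling by `meanFactor`
never enlarges the martingale increments. -/
lemma norm_meanFactor_le {c : ℝ} (hc : 0 < c) {w : ℂ} (hw : ‖w‖ ≤ 1) (N n : ℕ) :
    ‖meanFactor c w N n‖ ≤ 1 := by
  rw [meanFactor, norm_prod]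
  refine Finset.prod_le_one (fun _ _ => norm_nonneg _) fun k _ => ?_
  rw [norm_div, Complex.norm_real, Real.norm_of_nonneg (by positivity), div_le_one (by positivity)]
  refine (norm_add_le _ _).trans ?_
  rw [Complex.norm_real, Real.norm_of_nonneg (by positivity)]
  linarith

lemma meanFactor_eq_mul (c : ℝ) (w : ℂ) {k n : ℕ} (h : k < n) :
    meanFactor c w k n = (((k + c : ℝ) : ℂ) + w) / ((k + 1 + c : ℝ) : ℂ)
      * meanFactor c w (k + 1) n := by
  rw [meanFactor, Finset.prod_eq_prod_Ico_succ_bot h, meanFactor]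

lemma meanFactor_self (c : ℝ) (w : ℂ) (n : ℕ) : meanFactor c w n n = 1 := by simp [meanFactor]

/-- Telescoping, from `1 / (k + 1)² ≤ 1 / k - 1 / (k + 1)`. -/
lemma sum_Ico_inv_sq_le {N : ℕ} (hN : 0 < N) (n : ℕ) :
    ∑ k ∈ Finset.Ico N n, (1 / ((k : ℝ) + 1) ^ 2) ≤ 1 / (N : ℝ) := by
  rcases le_total n N with h | h
  · simp [Finset.Ico_eq_empty_of_le h]
  · suffices ∑ k ∈ Finset.Ico N n, (1 / ((k : ℝ) + 1) ^ 2) ≤ 1 / (N : ℝ) - 1 / (n : ℝ) by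
      have : (0 : ℝ) ≤ 1 / (n : ℝ) := by positivity
      linarith
    induction n, h using Nat.le_induction with
    | base => simp
    | succ n h ih =>
      rw [Finset.sum_Ico_succ_top h]
      have hn : (0 : ℝ) < n := by exact_mod_cast hN.trans_le h
      have : 1 / ((n : ℝ) + 1) ^ 2 ≤ 1 / (n : ℝ) - 1 / (n + 1) := by
        rw [div_sub_div _ _ hn.ne' (by positivity), div_le_div_iff₀ (by positivity) (by positivity)]
        nlinarith
      push_cast
      linarith

/-! ### Concentration of the normalised Fourier transform around its conditional mean. -/

section fourier

variable {E : Type*} [NormedAddCommGroup E] [InnerProductSpace ℝ E] [MeasurableSpace E]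

/-- The Fourier transform of the normalised composition at time `n`. -/
noncomputable def normCharFun {Ω : Type*} (M₀ : FiniteMeasure E) (M : ℕ → Ω → FiniteMeasure E)
    (n : ℕ) (s : E) (ω : Ω) : ℂ :=
  charFun (M n ω : Measure E) s / ((n + M₀.mass : ℝ) : ℂ)

variable [BorelSpace E] {Ω : Type*} {mΩ : MeasurableSpace Ω}
  {μ : Measure Ω} {M₀ : FiniteMeasure E} {R : Kernel E E} {M : ℕ → Ω → FiniteMeasure E}
  {ℱ : Filtration ℕ mΩ} {C : ℕ → Ω → E}

namespace IsPolyaScheme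


lemma charFun_succ [IsMarkovKernel R] (h : IsPolyaScheme μ M₀ R M ℱ C) (n : ℕ) (s : E) (ω : Ω) :
    charFun (M (n + 1) ω : Measure E) s
      = charFun (M n ω : Measure E) s + charFun (R (C n ω)) s := by
  simp only [charFun_apply]
  exact h.integral_succ (B := 1) (by fun_prop : Continuous _).stronglyMeasurable
    (fun x => (Complex.norm_exp_ofReal_mul_I _).le) n ω

lemma stronglyMeasurable_normCharFun [IsMarkovKernel R] (h : IsPolyaScheme μ M₀ R M ℱ C)
    (n : ℕ) (s : E) : StronglyMeasurable[ℱ n] (normCharFun M₀ M n s) := by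
  change StronglyMeasurable[ℱ n] fun ω => normCharFun M₀ M n s ω
  simp only [normCharFun, charFun_apply, div_eq_mul_inv]
  exact (h.stronglyMeasurable_integral (B := 1) (by fun_prop : Continuous _).stronglyMeasurable
    (fun x => (Complex.norm_exp_ofReal_mul_I _).le) n).mul_const _

omit [BorelSpace E] in
lemma norm_normCharFun_le [IsMarkovKernel R] (h : IsPolyaScheme μ M₀ R M ℱ C)
    (hM₀ : 0 < M₀.mass) (n : ℕ) (s : E) (ω : Ω) : ‖normCharFun M₀ M n s ω‖ ≤ 1 := by
  have hc : (0 : ℝ) < n + M₀.mass := by positivity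
  rw [normCharFun, norm_div, Complex.norm_real, Real.norm_of_nonneg hc.le, div_le_one hc,
    ← h.real_univ_eq n ω]
  exact norm_charFun_le _

/-- The martingale increments of the Fourier transform, with the mean growth factored out. -/
lemma meanFactor_mul_normCharFun_succ [IsMarkovKernel R] (h : IsPolyaScheme μ M₀ R M ℱ C)
    (hM₀ : 0 < M₀.mass) {s : E} {w : ℂ}
    (hw : ∀ x, charFun (R x) s = Complex.exp (inner ℝ x s * Complex.I) * w)
    {k n : ℕ} (hk : k < n) (ω : Ω) :
    meanFactor M₀.mass w (k + 1) n * normCharFun M₀ M (k + 1) s ω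
      - meanFactor M₀.mass w k n * normCharFun M₀ M k s ω
    = meanFactor M₀.mass w (k + 1) n * w / ((k + 1 + M₀.mass : ℝ) : ℂ)
      * (Complex.exp (inner ℝ (C k ω) s * Complex.I) - normCharFun M₀ M k s ω) := by
  have h1 : (((k : ℝ) + 1 + M₀.mass : ℝ) : ℂ) ≠ 0 := by
    rw [Complex.ofReal_ne_zero]; positivity
  have h2 : (((k : ℝ) + M₀.mass : ℝ) : ℂ) ≠ 0 := by
    rw [Complex.ofReal_ne_zero]; positivity
  rw [meanFactor_eq_mul _ _ hk]
  simp only [normCharFun, h.charFun_succ, hw]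
  rw [Nat.cast_add, Nat.cast_one]
  field_simp
  ring

/-- For fixed `n`, the process `meanFactor c w k n * Y_k(s)` is a martingale in `k ≤ n`, with
increments of modulus at most `2 / (k + 1)`. After scaling by `a`, the squares sum to at most `4 a²
/ N`. The condition `2 a ≤ N` keeps the scaled increments below `1`, and `u` selects a direction in
the complex plane. -/
lemma integral_exp_normCharFun_le [IsProbabilityMeasure μ] [IsMarkovKernel R]
    (h : IsPolyaScheme μ M₀ R M ℱ C) (hM₀ : 0 < M₀.mass) {s : E} {w : ℂ}
    (hw : ∀ x, charFun (R x) s = Complex.exp (inner ℝ x s * Complex.I) * w) (hw1 : ‖w‖ ≤ 1)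
    {u : ℂ} (hu : ‖u‖ ≤ 1) {N n : ℕ} (hN : 0 < N) (hNn : N ≤ n) {a : ℝ} (ha : 0 ≤ a)
    (haN : 2 * a ≤ N) :
    ∫ ω, Real.exp (a * (u * (normCharFun M₀ M n s ω
      - meanFactor M₀.mass w N n * normCharFun M₀ M N s ω)).re) ∂μ ≤ Real.exp (4 * a ^ 2 / N) := by
  set c : ℝ := (M₀.mass : ℝ) with hc_def
  have hc : 0 < c := by exact_mod_cast hM₀
  set X : ℕ → Ω → ℝ := fun k ω =>
    a * (u * (meanFactor c w k n * normCharFun M₀ M k s ω)).re with hXdef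
  have hNpos : (0 : ℝ) < N := by exact_mod_cast hN
  have hXn : ∀ ω, a * (u * (normCharFun M₀ M n s ω
      - meanFactor c w N n * normCharFun M₀ M N s ω)).re = X n ω - X N ω := by
    intro ω
    simp only [hXdef, meanFactor_self, one_mul]
    rw [mul_sub, Complex.sub_re, mul_sub]
  simp only [hXn]
  set b : ℕ → ℂ := fun k => u * (meanFactor c w (k + 1) n * w / ((k + 1 + c : ℝ) : ℂ)) with hb_def
  have hb : ∀ k, ‖b k‖ ≤ 1 / ((k : ℝ) + 1) := by
    intro k
    have h1 := norm_meanFactor_le hc hw1 (k + 1) n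
    have h2 : ‖meanFactor c w (k + 1) n * w‖ ≤ 1 := by
      rw [norm_mul]; exact mul_le_one₀ h1 (norm_nonneg _) hw1
    simp only [hb_def]
    rw [norm_mul, norm_div, Complex.norm_real, Real.norm_of_nonneg (by positivity)]
    calc _ ≤ 1 * (1 / ((k : ℝ) + 1)) := by
          rw [div_eq_mul_one_div (‖meanFactor c w (k + 1) n * w‖)]
          have h3 : 1 / ((k : ℝ) + 1 + c) ≤ 1 / ((k : ℝ) + 1) :=
            one_div_le_one_div_of_le (by positivity) (by linarith)
          exact mul_le_mul hu ((mul_le_of_le_one_left (by positivity) h2).trans h3)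
            (by positivity) zero_le_one
      _ = _ := one_mul _
  have hinc : ∀ k, k < n → ∀ ω, X (k + 1) ω - X k ω
      = a * (b k * Complex.exp (inner ℝ (C k ω) s * Complex.I)).re
        - a * (b k * normCharFun M₀ M k s ω).re := by
    intro k hk ω
    have := h.meanFactor_mul_normCharFun_succ hM₀ hw hk ω
    simp only [hXdef]
    rw [← mul_sub, ← Complex.sub_re, ← mul_sub, this, ← mul_sub, ← Complex.sub_re, ← mul_sub,
      ← mul_assoc u]
  have hsum : ∑ k ∈ Finset.Ico N n, (a * (2 / ((k : ℝ) + 1))) ^ 2 ≤ 4 * a ^ 2 / N := by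
    calc _ = 4 * a ^ 2 * ∑ k ∈ Finset.Ico N n, (1 / ((k : ℝ) + 1) ^ 2) := by
          rw [Finset.mul_sum]
          refine Finset.sum_congr rfl fun k _ => ?_
          field_simp
          ring
      _ ≤ 4 * a ^ 2 * (1 / N) := by gcongr; exact sum_Ico_inv_sq_le hN n
      _ = _ := by ring
  refine (integral_exp_sub_le_of_bounded_increments (ℱ := ℱ) (X := X)
    (v := fun k => a * (2 / ((k : ℝ) + 1))) hNn ?_ ?_ ?_ ?_).trans (Real.exp_le_exp.2 hsum)
  · intro k _
    exact (Complex.continuous_re.comp_stronglyMeasurable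
      (((h.stronglyMeasurable_normCharFun k s).const_mul _).const_mul u)).const_mul a
  · intro k _ hk ω
    rw [hinc k hk ω, ← mul_sub, ← Complex.sub_re, ← mul_sub, abs_mul, abs_of_nonneg ha]
    gcongr
    refine (Complex.abs_re_le_norm _).trans ?_
    rw [norm_mul]
    have h1 : ‖Complex.exp (inner ℝ (C k ω) s * Complex.I) - normCharFun M₀ M k s ω‖ ≤ 2 := by
      refine (norm_sub_le _ _).trans ?_
      rw [Complex.norm_exp_ofReal_mul_I]
      linarith [h.norm_normCharFun_le hM₀ k s ω]
    calc _ ≤ 1 / ((k : ℝ) + 1) * 2 := by gcongr; exact hb k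
      _ = _ := by ring
  · intro k hk _
    have : (N : ℝ) ≤ k := by exact_mod_cast hk
    rw [← mul_div_assoc, div_le_one (by positivity)]
    linarith
  · intro k _ hk
    -- The part of the increment that depends on the new colour is `f (C k)`; its conditional mean
    -- is the subtracted term, because `Y_k(s)` is the mean of `e^{i⟨x,s⟩}` under the conditional
    -- law of `C k`.
    set f : E → ℝ := fun x => a * (b k * Complex.exp (inner ℝ x s * Complex.I)).re with hf_def
    have hfc : Continuous f := by fun_prop
    have hfB : ∀ x, ‖f x‖ ≤ a * ‖b k‖ := by
      intro x
      rw [hf_def, norm_mul, Real.norm_of_nonneg ha]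
      gcongr
      refine (Complex.abs_re_le_norm _).trans ?_
      rw [norm_mul, Complex.norm_exp_ofReal_mul_I, mul_one]
    have hg : StronglyMeasurable[ℱ k] fun ω => a * (b k * normCharFun M₀ M k s ω).re :=
      (Complex.continuous_re.comp_stronglyMeasurable
        ((h.stronglyMeasurable_normCharFun k s).const_mul _)).const_mul a
    have hgi : Integrable (fun ω => a * (b k * normCharFun M₀ M k s ω).re) μ := by
      refine .of_bound (hg.mono (ℱ.le _)).aestronglyMeasurable (a * (‖b k‖ * 1))
        (ae_of_all _ fun ω => ?_)
      rw [norm_mul, Real.norm_of_nonneg ha]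
      gcongr
      refine (Complex.abs_re_le_norm _).trans ?_
      rw [norm_mul]
      gcongr
      exact h.norm_normCharFun_le hM₀ k s ω
    have hfi : Integrable (fun ω => f (C k ω)) μ :=
      .of_bound (hfc.measurable.comp (h.measurable_color' k)).aestronglyMeasurable _
        (ae_of_all _ fun ω => hfB _)
    have heq : X (k + 1) - X k
        = (fun ω => f (C k ω)) - fun ω => a * (b k * normCharFun M₀ M k s ω).re := by
      ext ω; exact hinc k hk ω
    rw [heq]
    filter_upwards [condExp_sub hfi hgi (ℱ k), h.condExp_color hM₀ k hfc.measurable hfB]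
      with ω h1 h2
    rw [h1, Pi.sub_apply, h2, condExp_of_stronglyMeasurable (ℱ.le k) hg hgi, Pi.zero_apply,
      sub_eq_zero]
    simp only [hf_def]
    have hi : Integrable (fun x => b k * Complex.exp (inner ℝ x s * Complex.I))
        (M k ω : Measure E) := by
      refine .of_bound (by fun_prop : Continuous _).aestronglyMeasurable ‖b k‖
        (ae_of_all _ fun x => ?_)
      rw [norm_mul, Complex.norm_exp_ofReal_mul_I, mul_one]
    have hre := integral_re hi
    simp only [RCLike.re_eq_complex_re] at hre
    rw [integral_const_mul, hre, integral_const_mul, normCharFun, charFun_apply, ← mul_div_assoc,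
      Complex.div_ofReal_re]
    ring

/-- Chernoff's bound in the four directions `±1`, `±i`: a complex number whose real and imaginary
parts are below `ε / 2` in absolute value has modulus below `ε`. The parameter `a` stays free so
that it can be tuned to `N`. -/
lemma measureReal_normCharFun_sub_ge_le [IsProbabilityMeasure μ] [IsMarkovKernel R]
    (h : IsPolyaScheme μ M₀ R M ℱ C) (hM₀ : 0 < M₀.mass) {s : E} {w : ℂ}
    (hw : ∀ x, charFun (R x) s = Complex.exp (inner ℝ x s * Complex.I) * w) (hw1 : ‖w‖ ≤ 1)
    {N n : ℕ} (hN : 0 < N) (hNn : N ≤ n) {a : ℝ} (ha : 0 ≤ a) (haN : 2 * a ≤ N) (ε : ℝ) :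
    μ.real {ω | ε ≤ ‖normCharFun M₀ M n s ω
      - meanFactor M₀.mass w N n * normCharFun M₀ M N s ω‖}
      ≤ 4 * Real.exp (4 * a ^ 2 / N - a * (ε / 2)) := by
  set Z : Ω → ℂ := fun ω => normCharFun M₀ M n s ω
      - meanFactor M₀.mass w N n * normCharFun M₀ M N s ω with hZ
  have hZm : StronglyMeasurable Z := ((h.stronglyMeasurable_normCharFun n s).mono (ℱ.le _)).sub
    (((h.stronglyMeasurable_normCharFun N s).mono (ℱ.le _)).const_mul _)
  have hZb : ∀ ω, ‖Z ω‖ ≤ 2 := by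
    intro ω
    refine (norm_sub_le _ _).trans ?_
    rw [norm_mul]
    have h1 := h.norm_normCharFun_le hM₀ n s ω
    have hc : (0 : ℝ) < M₀.mass := by exact_mod_cast hM₀
    have h2 := mul_le_one₀ (norm_meanFactor_le hc hw1 N n) (norm_nonneg _)
      (h.norm_normCharFun_le hM₀ N s ω)
    linarith
  have tail : ∀ u : ℂ, ‖u‖ ≤ 1 → μ.real {ω | ε / 2 ≤ (u * Z ω).re}
      ≤ Real.exp (4 * a ^ 2 / N - a * (ε / 2)) := by
    intro u hu
    have h1 := h.integral_exp_normCharFun_le hM₀ hw hw1 hu hN hNn ha haN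
    have hint : Integrable (fun ω => Real.exp (a * (u * Z ω).re)) μ := by
      refine .of_bound (Real.continuous_exp.comp_stronglyMeasurable
        ((Complex.continuous_re.comp_stronglyMeasurable (hZm.const_mul u)).const_mul
          a)).aestronglyMeasurable (Real.exp (a * 2)) (ae_of_all _ fun ω => ?_)
      rw [Real.norm_of_nonneg (Real.exp_pos _).le, Real.exp_le_exp]
      gcongr
      refine (Complex.re_le_norm _).trans ?_
      rw [norm_mul]
      nlinarith [hZb ω, norm_nonneg (Z ω), norm_nonneg u]
    refine (measure_ge_le_exp_mul_mgf (ε / 2) ha hint).trans ?_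
    calc _ ≤ Real.exp (-a * (ε / 2)) * Real.exp (4 * a ^ 2 / N) := by gcongr; exact h1
      _ = _ := by rw [← Real.exp_add]; ring_nf
  have hsub : {ω | ε ≤ ‖Z ω‖} ⊆ ({ω | ε / 2 ≤ (1 * Z ω).re} ∪ {ω | ε / 2 ≤ (-1 * Z ω).re})
      ∪ ({ω | ε / 2 ≤ (Complex.I * Z ω).re} ∪ {ω | ε / 2 ≤ (-Complex.I * Z ω).re}) := by
    intro ω hω
    by_contra hcon
    simp only [Set.mem_union, Set.mem_ofPred_eq, not_or, not_le, one_mul, neg_mul, Complex.neg_re,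
      Complex.I_mul_re, neg_neg] at hcon
    obtain ⟨⟨h1, h2⟩, h3, h4⟩ := hcon
    have h5 : ‖Z ω‖ ≤ |(Z ω).re| + |(Z ω).im| := Complex.norm_le_abs_re_add_abs_im _
    have h6 : |(Z ω).re| < ε / 2 := abs_lt.2 ⟨by linarith, h1⟩
    have h7 : |(Z ω).im| < ε / 2 := abs_lt.2 ⟨by linarith, h4⟩
    have h8 : ε ≤ ‖Z ω‖ := hω
    linarith
  have t1 := tail 1 (by simp)
  have t2 := tail (-1) (by simp)
  have t3 := tail Complex.I (by simp)
  have t4 := tail (-Complex.I) (by simp)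
  refine (measureReal_mono hsub).trans ?_
  refine (measureReal_union_le _ _).trans ?_
  have u1 := measureReal_union_le (μ := μ) {ω | ε / 2 ≤ (1 * Z ω).re} {ω | ε / 2 ≤ (-1 * Z ω).re}
  have u2 := measureReal_union_le (μ := μ) {ω | ε / 2 ≤ (Complex.I * Z ω).re}
    {ω | ε / 2 ≤ (-Complex.I * Z ω).re}
  linarith

end IsPolyaScheme
end fourier

/-! ### Almost sure control of the mass far from the origin. -/

section truncation

variable {E : Type*} [NormedAddCommGroup E] [MeasurableSpace E]

omit [MeasurableSpace E] in
lemma norm_truncation_le {r : ℝ} (hr : 0 < r) (x : E) : ‖min 1 (‖x‖ / r)‖ ≤ 1 := by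
  rw [Real.norm_of_nonneg (by positivity)]
  exact min_le_left _ _

/-- The mean of the truncated norm `min 1 (‖x‖ / r)` under the normalised composition. -/
noncomputable def truncMean {Ω : Type*} (M₀ : FiniteMeasure E) (M : ℕ → Ω → FiniteMeasure E)
    (r : ℝ) (n : ℕ) (ω : Ω) : ℝ :=
  ((n : ℝ) + M₀.mass)⁻¹ * ∫ x, min 1 (‖x‖ / r) ∂(M n ω : Measure E)

lemma truncMean_nonneg {Ω : Type*} {M₀ : FiniteMeasure E} {M : ℕ → Ω → FiniteMeasure E}
    {r : ℝ} (hr : 0 < r) (n : ℕ) (ω : Ω) : 0 ≤ truncMean M₀ M r n ω :=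
  mul_nonneg (by positivity) (integral_nonneg fun x => by positivity)

variable [BorelSpace E]

lemma tendsto_integral_truncation (m : Measure E) [IsFiniteMeasure m] {r : ℕ → ℝ}
    (hr : ∀ n, 0 < r n) (hrt : Tendsto r atTop atTop) :
    Tendsto (fun n => ∫ x, min 1 (‖x‖ / r n) ∂m) atTop (𝓝 0) := by
  have : Tendsto (fun n => ∫ x, min 1 (‖x‖ / r n) ∂m) atTop (𝓝 (∫ _, 0 ∂m)) := by
    refine tendsto_integral_of_dominated_convergence (fun _ => 1)
      (fun n => (by fun_prop : Measurable _).aestronglyMeasurable) (integrable_const _)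
      (fun n => ae_of_all _ (norm_truncation_le (hr n))) (ae_of_all _ fun x => ?_)
    have h1 : Tendsto (fun n => ‖x‖ / r n) atTop (𝓝 0) := hrt.const_div_atTop _
    simpa using (tendsto_const_nhds (x := (1 : ℝ))).min h1
  simpa using this

variable {Ω : Type*} {mΩ : MeasurableSpace Ω}
  {μ : Measure Ω} {M₀ : FiniteMeasure E} {R : Kernel E E} {M : ℕ → Ω → FiniteMeasure E}
  {ℱ : Filtration ℕ mΩ} {C : ℕ → Ω → E}

namespace IsPolyaScheme

lemma stronglyMeasurable_truncMean [IsMarkovKernel R] (h : IsPolyaScheme μ M₀ R M ℱ C)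
    {r : ℝ} (hr : 0 < r) (n : ℕ) : StronglyMeasurable[ℱ n] (truncMean M₀ M r n) :=
  (h.stronglyMeasurable_integral (B := 1) (by fun_prop : Measurable _).stronglyMeasurable
    (norm_truncation_le hr) n).const_mul _

omit [BorelSpace E] in
lemma truncMean_le_one [IsMarkovKernel R] (h : IsPolyaScheme μ M₀ R M ℱ C) (hM₀ : 0 < M₀.mass)
    {r : ℝ} (hr : 0 < r) (n : ℕ) (ω : Ω) : truncMean M₀ M r n ω ≤ 1 := by
  have h1 := (le_abs_self _).trans (h.norm_integral_le (norm_truncation_le (E := E) hr) n ω)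
  rw [truncMean, inv_mul_le_iff₀ (by positivity)]
  linarith

lemma integrable_truncMean [IsFiniteMeasure μ] [IsMarkovKernel R]
    (h : IsPolyaScheme μ M₀ R M ℱ C) (hM₀ : 0 < M₀.mass) {r : ℝ} (hr : 0 < r) (n : ℕ) :
    Integrable (truncMean M₀ M r n) μ :=
  .of_bound ((h.stronglyMeasurable_truncMean hr n).mono (ℱ.le n)).aestronglyMeasurable 1
    (ae_of_all _ fun ω => by
      rw [Real.norm_of_nonneg (truncMean_nonneg hr n ω)]
      exact h.truncMean_le_one hM₀ hr n ω)

/-- In mean, a drawn colour contributes the current truncated mean plus at most `L / r`, with weight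
`1 / (n + 1 + c)`, and enlarging the radius only decreases the truncated norm. So `truncMean` along
growing radii is a supermartingale up to a drift that is summable for a suitable choice of radii. -/
lemma condExp_truncMean_succ_le [IsProbabilityMeasure μ] [IsMarkovKernel R]
    (h : IsPolyaScheme μ M₀ R M ℱ C) (hM₀ : 0 < M₀.mass) {L : ℝ} (hL : 0 ≤ L)
    (hR : ∀ r : ℝ, 0 < r → ∀ x, ∫ y, min 1 (‖y‖ / r) ∂(R x) ≤ min 1 (‖x‖ / r) + L / r)
    {r r' : ℝ} (hr : 0 < r) (hrr' : r ≤ r') (n : ℕ) :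
    μ[truncMean M₀ M r' (n + 1) | ℱ n] ≤ᵐ[μ]
      fun ω => truncMean M₀ M r n ω + L / r * (1 / ((n : ℝ) + 1)) := by
  have hr' := hr.trans_le hrr'
  have hc : (0 : ℝ) < M₀.mass := by exact_mod_cast hM₀
  have hn : (0 : ℝ) < n + M₀.mass := by positivity
  have hn1 : (0 : ℝ) < n + 1 + M₀.mass := by positivity
  have hfm : Measurable fun x : E => min 1 (‖x‖ / r) := by fun_prop
  have hFi := h.integrable_truncMean hM₀ hr n
  have hCi : Integrable (fun ω => min 1 (‖C n ω‖ / r)) μ :=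
    .of_bound (hfm.comp (h.measurable_color' n)).aestronglyMeasurable 1
      (ae_of_all _ fun ω => norm_truncation_le hr _)
  set a : ℝ := ((n : ℝ) + 1 + M₀.mass)⁻¹ with ha
  set g : Ω → ℝ := fun ω =>
    a * ((n + M₀.mass) * truncMean M₀ M r n ω) + a * (L / r) with hg
  have hgm : StronglyMeasurable[ℱ n] g :=
    (((h.stronglyMeasurable_truncMean hr n).const_mul _).const_mul _).add stronglyMeasurable_const
  have hgi : Integrable g μ := ((hFi.const_mul _).const_mul _).add (integrable_const _)
  have hle : truncMean M₀ M r' (n + 1) ≤ᵐ[μ] g + a • fun ω => min 1 (‖C n ω‖ / r) := by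
    refine ae_of_all _ fun ω => ?_
    have h1 : ∫ x, min 1 (‖x‖ / r') ∂(M (n + 1) ω : Measure E)
        ≤ ∫ x, min 1 (‖x‖ / r) ∂(M (n + 1) ω : Measure E) := by
      refine integral_mono
        (.of_bound (by fun_prop : Measurable _).aestronglyMeasurable 1
          (ae_of_all _ (norm_truncation_le hr')))
        (.of_bound hfm.aestronglyMeasurable 1 (ae_of_all _ (norm_truncation_le hr))) fun x => ?_
      gcongr
    rw [h.integral_succ hfm.stronglyMeasurable (norm_truncation_le hr)] at h1
    have h2 := hR r hr (C n ω)
    have h3 : ((n : ℝ) + M₀.mass) * truncMean M₀ M r n ω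
        = ∫ x, min 1 (‖x‖ / r) ∂(M n ω : Measure E) := by
      rw [truncMean, mul_inv_cancel_left₀ hn.ne']
    simp only [Pi.add_apply, Pi.smul_apply, smul_eq_mul, hg, h3]
    rw [truncMean, Nat.cast_add, Nat.cast_one, ← mul_add, ← mul_add]
    have ha0 : 0 ≤ a := by positivity
    refine mul_le_mul_of_nonneg_left ?_ ha0
    linarith
  have hmono := condExp_mono (m := ℱ n) (h.integrable_truncMean hM₀ hr' (n + 1))
    (hgi.add (hCi.smul a)) hle
  filter_upwards [hmono, condExp_add hgi (hCi.smul a) (ℱ n),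
    condExp_smul a (fun ω => min 1 (‖C n ω‖ / r)) (ℱ n) (μ := μ),
    h.condExp_color hM₀ n hfm (norm_truncation_le hr)] with ω h1 h2 h3 h4
  refine h1.trans ?_
  rw [h2, Pi.add_apply, h3, Pi.smul_apply, h4, condExp_of_stronglyMeasurable (ℱ.le n) hgm hgi]
  change a * ((n + M₀.mass) * truncMean M₀ M r n ω) + a * (L / r) + a * truncMean M₀ M r n ω ≤ _
  -- The weights `n + c` and `1` add up to `a⁻¹`, so only the drift remains.
  have h5 : a * ((n + M₀.mass) * truncMean M₀ M r n ω) + a * truncMean M₀ M r n ω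
      = truncMean M₀ M r n ω := by
    rw [ha]; field_simp; ring
  have h6 : a ≤ 1 / ((n : ℝ) + 1) := by
    rw [ha, ← one_div]
    exact one_div_le_one_div_of_le (by positivity) (by linarith)
  have h7 : a * (L / r) ≤ L / r * (1 / ((n : ℝ) + 1)) := by
    rw [mul_comm]; gcongr
  linarith

/-- Here the radius is frozen along the whole evolution. Taking it equal to `r n` at the end makes
the expectation vanish in the limit, which identifies the almost sure limit obtained with moving
radii. -/
lemma integral_truncMean_le [IsProbabilityMeasure μ] [IsMarkovKernel R]
    (h : IsPolyaScheme μ M₀ R M ℱ C) (hM₀ : 0 < M₀.mass) {L : ℝ} (hL : 0 ≤ L)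
    (hR : ∀ r : ℝ, 0 < r → ∀ x, ∫ y, min 1 (‖y‖ / r) ∂(R x) ≤ min 1 (‖x‖ / r) + L / r)
    {r : ℝ} (hr : 0 < r) (n : ℕ) :
    ∫ ω, truncMean M₀ M r n ω ∂μ ≤ (M₀.mass : ℝ)⁻¹ * ∫ x, min 1 (‖x‖ / r) ∂(M₀ : Measure E)
      + L / r * ∑ k ∈ Finset.range n, 1 / ((k : ℝ) + 1) := by
  induction n with
  | zero => simp [truncMean, h.zero]
  | succ n ih =>
    have h1 := integral_mono_ae integrable_condExp
      ((h.integrable_truncMean hM₀ hr n).add (integrable_const _))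
      (h.condExp_truncMean_succ_le hM₀ hL hR hr le_rfl n)
    rw [integral_condExp (ℱ.le n),
      integral_add' (h.integrable_truncMean hM₀ hr n) (integrable_const _)] at h1
    simp only [integral_const, probReal_univ, one_smul] at h1
    rw [Finset.sum_range_succ, mul_add]
    linarith

/-- The normalised composition at time `n` puts asymptotically no mass at distances of
order `r n` from the origin. -/
lemma ae_tendsto_truncMean [IsProbabilityMeasure μ] [IsMarkovKernel R]
    (h : IsPolyaScheme μ M₀ R M ℱ C) (hM₀ : 0 < M₀.mass) {L : ℝ} (hL : 0 ≤ L)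
    (hR : ∀ r : ℝ, 0 < r → ∀ x, ∫ y, min 1 (‖y‖ / r) ∂(R x) ≤ min 1 (‖x‖ / r) + L / r)
    {r : ℕ → ℝ} (hr : ∀ n, 0 < r n) (hmono : Monotone r) (hrt : Tendsto r atTop atTop)
    (hsum : Summable fun n : ℕ => 1 / r n * (1 / ((n : ℝ) + 1)))
    (hharm : Tendsto (fun n => 1 / r n * ∑ k ∈ Finset.range n, 1 / ((k : ℝ) + 1)) atTop (𝓝 0)) :
    ∀ᵐ ω ∂μ, Tendsto (fun n => truncMean M₀ M (r n) n ω) atTop (𝓝 0) := by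
  set b : ℕ → ℝ := fun n => L / r n * (1 / ((n : ℝ) + 1)) with hb
  have hb0 : ∀ n, 0 ≤ b n := fun n => by have := hr n; positivity
  have hbs : Summable b := by
    refine (hsum.mul_left L).congr fun n => ?_
    simp only [hb]; ring
  -- Compensating the drift gives a bounded submartingale, hence almost sure convergence to a limit
  -- still to be identified.
  set T : ℕ → Ω → ℝ := fun n ω => ∑ k ∈ Finset.range n, b k - truncMean M₀ M (r n) n ω with hT
  have hTm : ∀ n, StronglyMeasurable[ℱ n] (T n) := fun n =>
    stronglyMeasurable_const.sub (h.stronglyMeasurable_truncMean (hr n) n)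
  have hTi : ∀ n, Integrable (T n) μ := fun n =>
    (integrable_const _).sub (h.integrable_truncMean hM₀ (hr n) n)
  have hsub : Submartingale T ℱ μ := by
    refine submartingale_nat hTm hTi fun n => ?_
    have hi := h.integrable_truncMean hM₀ (hr (n + 1)) (n + 1)
    filter_upwards [h.condExp_truncMean_succ_le hM₀ hL hR (hr n) (hmono n.le_succ) n,
      condExp_sub (integrable_const (∑ k ∈ Finset.range (n + 1), b k)) hi (ℱ n)] with ω h1 h2
    have h3 : μ[T (n + 1) | ℱ n] ω = ∑ k ∈ Finset.range (n + 1), b k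
        - μ[truncMean M₀ M (r (n + 1)) (n + 1) | ℱ n] ω := by
      refine Eq.trans ?_ (h2.trans ?_)
      · rfl
      · rw [Pi.sub_apply, condExp_const (ℱ.le n)]
    rw [h3, Finset.sum_range_succ]
    simp only [hT]
    linarith
  have hbdd : ∀ n, eLpNorm (T n) 1 μ ≤ ((∑' k, b k) + 1).toNNReal := by
    intro n
    have hae : ∀ᵐ ω ∂μ, ‖T n ω‖ ≤ (∑' k, b k) + 1 := by
      refine ae_of_all _ fun ω => ?_
      have h1 := truncMean_nonneg (M₀ := M₀) (M := M) (hr n) n ω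
      have h2 := h.truncMean_le_one hM₀ (hr n) n ω
      have h3 := hbs.sum_le_tsum (Finset.range n) fun k _ => hb0 k
      have h4 : 0 ≤ ∑ k ∈ Finset.range n, b k := Finset.sum_nonneg fun k _ => hb0 k
      rw [Real.norm_eq_abs, abs_le]
      simp only [hT]
      constructor <;> linarith
    refine (eLpNorm_le_of_ae_bound hae).trans ?_
    simp [ENNReal.ofReal]
  have hconv := hsub.exists_ae_tendsto_of_bdd hbdd
  set ℓ : Ω → ℝ := fun ω => (∑' k, b k) - limUnder atTop fun n => T n ω with hℓ
  have hconv' : ∀ᵐ ω ∂μ, Tendsto (fun n => truncMean M₀ M (r n) n ω) atTop (𝓝 (ℓ ω)) := by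
    filter_upwards [hconv] with ω hω
    refine (hbs.hasSum.tendsto_sum_nat.sub (tendsto_nhds_limUnder hω)).congr fun n => ?_
    simp only [hT]; ring
  have hlim : Tendsto (fun n => ∫ ω, truncMean M₀ M (r n) n ω ∂μ) atTop (𝓝 (∫ ω, ℓ ω ∂μ)) := by
    refine tendsto_integral_of_dominated_convergence (fun _ => 1)
      (fun n => (h.integrable_truncMean hM₀ (hr n) n).aestronglyMeasurable) (integrable_const _)
      (fun n => ae_of_all _ fun ω => ?_) hconv'
    rw [Real.norm_of_nonneg (truncMean_nonneg (hr n) n ω)]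
    exact h.truncMean_le_one hM₀ (hr n) n ω
  have hlim0 : Tendsto (fun n => ∫ ω, truncMean M₀ M (r n) n ω ∂μ) atTop (𝓝 0) := by
    have h1 := ((tendsto_integral_truncation (M₀ : Measure E) hr hrt).const_mul
      (M₀.mass : ℝ)⁻¹).add (hharm.const_mul L)
    rw [mul_zero, mul_zero, add_zero] at h1
    refine squeeze_zero (fun n => integral_nonneg fun ω => truncMean_nonneg (hr n) n ω)
      (fun n => ?_) h1
    refine (h.integral_truncMean_le hM₀ hL hR (hr n) n).trans (le_of_eq ?_)
    ring
  have hℓ0 : 0 ≤ᵐ[μ] ℓ := by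
    filter_upwards [hconv'] with ω hω
    exact ge_of_tendsto' hω fun n => truncMean_nonneg (hr n) n ω
  have hℓi : Integrable ℓ μ := by
    refine .of_bound (C := 1) (aestronglyMeasurable_of_tendsto_ae _
      (fun n => (h.integrable_truncMean hM₀ (hr n) n).aestronglyMeasurable) hconv') ?_
    filter_upwards [hconv', hℓ0] with ω hω h0
    rw [Real.norm_of_nonneg h0]
    exact le_of_tendsto' hω fun n => h.truncMean_le_one hM₀ (hr n) n ω
  -- The limit is non-negative with zero mean.
  have hzero := (integral_eq_zero_iff_of_nonneg_ae hℓ0 hℓi).1 (tendsto_nhds_unique hlim hlim0)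
  filter_upwards [hconv', hzero] with ω hω h0
  rwa [h0] at hω

end IsPolyaScheme

end truncation

/-! ### Asymptotics of the mean growth factor. -/

section meanFactor

lemma sum_range_one_div_le (n : ℕ) :
    ∑ k ∈ Finset.range n, 1 / ((k : ℝ) + 1) ≤ 1 + Real.log n := by
  refine le_trans (le_of_eq ?_) (harmonic_le_one_add_log n)
  simp [harmonic]

/-- A partial sum of the harmonic series shifted by `c` is logarithmic up to `O(log N)`. -/
lemma abs_sum_Ico_sub_log_le {c : ℝ} (hc : 0 < c) {N n : ℕ} (hN : 0 < N) (h : N ≤ n) :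
    |∑ k ∈ Finset.Ico N n, 1 / ((k : ℝ) + 1 + c) - Real.log n| ≤ 1 + Real.log (N + 1 + c) := by
  have hNr : (0 : ℝ) < N := by exact_mod_cast hN
  have hn : (0 : ℝ) < n := by exact_mod_cast hN.trans_le h
  have hlogN : 0 ≤ Real.log (N + 1 + c) := Real.log_nonneg (by linarith)
  rw [abs_le]
  constructor
  · have key : Real.log (n + 1 + c) - Real.log (N + 1 + c)
        ≤ ∑ k ∈ Finset.Ico N n, 1 / ((k : ℝ) + 1 + c) := by
      clear hn
      induction n, h using Nat.le_induction with
      | base => simp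
      | succ n h ih =>
        rw [Finset.sum_Ico_succ_top h]
        have hp : (0 : ℝ) < (n : ℝ) + 1 + c := by positivity
        have h1 : Real.log (((n + 1 : ℕ) : ℝ) + 1 + c) - Real.log ((n : ℝ) + 1 + c)
            ≤ 1 / ((n : ℝ) + 1 + c) := by
          rw [← Real.log_div (by positivity) hp.ne']
          refine (Real.log_le_sub_one_of_pos (by positivity)).trans (le_of_eq ?_)
          push_cast
          field_simp
          ring
        linarith
    have h2 : Real.log n ≤ Real.log (n + 1 + c) := Real.log_le_log hn (by linarith)
    linarith
  · have h1 : ∑ k ∈ Finset.Ico N n, 1 / ((k : ℝ) + 1 + c)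
        ≤ ∑ k ∈ Finset.range n, 1 / ((k : ℝ) + 1) := by
      rw [Finset.range_eq_Ico]
      refine (Finset.sum_le_sum fun k _ => ?_).trans
        (Finset.sum_le_sum_of_subset_of_nonneg (Finset.Ico_subset_Ico_left (Nat.zero_le N))
          fun k _ _ => by positivity)
      exact one_div_le_one_div_of_le (by positivity) (by linarith)
    linarith [sum_range_one_div_le n]

lemma Complex.norm_log_one_add_sub_self_le_sq {x : ℂ} (hx : ‖x‖ ≤ 1 / 2) :
    ‖Complex.log (1 + x) - x‖ ≤ ‖x‖ ^ 2 := by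
  refine (Complex.norm_log_one_add_sub_self_le (by linarith)).trans ?_
  have h1 : (1 - ‖x‖)⁻¹ ≤ 2 := by
    rw [inv_le_comm₀ (by linarith) (by norm_num)]
    linarith
  nlinarith [sq_nonneg ‖x‖]

/-- Each factor is `1 + x k` with `x k = -(1 - w) / (k + 1 + c)`. Replacing `log (1 + x k)` by `x k`
costs at most `‖x k‖²`, and these errors sum to at most `‖1 - w‖²` because `N ≥ 1`. -/
lemma exists_meanFactor_eq_exp {c : ℝ} (hc : 0 < c) {w : ℂ} (hw : ‖1 - w‖ ≤ 1 / 2) {N : ℕ}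
    (hN : 0 < N) (n : ℕ) :
    ∃ e : ℂ, ‖e‖ ≤ ‖1 - w‖ ^ 2 ∧ meanFactor c w N n
      = Complex.exp (-(1 - w) * ((∑ k ∈ Finset.Ico N n, 1 / ((k : ℝ) + 1 + c) : ℝ) : ℂ) + e) := by
  set x : ℕ → ℂ := fun k => -(1 - w) * ((1 / ((k : ℝ) + 1 + c) : ℝ) : ℂ) with hx
  have hxn : ∀ k, ‖x k‖ ≤ ‖1 - w‖ * (1 / ((k : ℝ) + 1)) := by
    intro k
    simp only [hx]
    rw [norm_mul, norm_neg, Complex.norm_real, Real.norm_of_nonneg (by positivity)]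
    have : 1 / ((k : ℝ) + 1 + c) ≤ 1 / ((k : ℝ) + 1) :=
      one_div_le_one_div_of_le (by positivity) (by linarith)
    gcongr
  have hxh : ∀ k, ‖x k‖ ≤ 1 / 2 := by
    intro k
    refine (hxn k).trans ?_
    have : 1 / ((k : ℝ) + 1) ≤ 1 := by
      rw [div_le_one (by positivity)]; linarith [(Nat.cast_nonneg k : (0 : ℝ) ≤ k)]
    nlinarith [norm_nonneg (1 - w)]
  refine ⟨∑ k ∈ Finset.Ico N n, (Complex.log (1 + x k) - x k), ?_, ?_⟩
  · refine (norm_sum_le _ _).trans ?_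
    calc _ ≤ ∑ k ∈ Finset.Ico N n, ‖1 - w‖ ^ 2 * (1 / ((k : ℝ) + 1) ^ 2) := by
          refine Finset.sum_le_sum fun k _ => ?_
          refine (Complex.norm_log_one_add_sub_self_le_sq (hxh k)).trans ?_
          calc _ ≤ (‖1 - w‖ * (1 / ((k : ℝ) + 1))) ^ 2 := by gcongr; exact hxn k
            _ = _ := by rw [mul_pow, div_pow, one_pow]
      _ ≤ ‖1 - w‖ ^ 2 * 1 := by
          rw [← Finset.mul_sum]
          gcongr
          refine (sum_Ico_inv_sq_le hN n).trans ?_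
          rw [div_le_one (by exact_mod_cast hN)]
          exact_mod_cast hN
      _ = _ := mul_one _
  · have h1 : -(1 - w) * ((∑ k ∈ Finset.Ico N n, 1 / ((k : ℝ) + 1 + c) : ℝ) : ℂ)
        + ∑ k ∈ Finset.Ico N n, (Complex.log (1 + x k) - x k)
        = ∑ k ∈ Finset.Ico N n, Complex.log (1 + x k) := by
      rw [Complex.ofReal_sum, Finset.mul_sum, ← Finset.sum_add_distrib]
      refine Finset.sum_congr rfl fun k _ => ?_
      simp only [hx]
      ring
    rw [h1, Complex.exp_sum, meanFactor]
    refine Finset.prod_congr rfl fun k _ => ?_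
    have hne : 1 + x k ≠ 0 := by
      intro h0
      have : ‖x k‖ = 1 := by
        rw [eq_neg_of_add_eq_zero_right h0, norm_neg, norm_one]
      linarith [hxh k]
    rw [Complex.exp_log hne]
    have : ((k : ℂ) + 1 + c) ≠ 0 := by
      have : (((k : ℝ) + 1 + c : ℝ) : ℂ) ≠ 0 := by
        rw [Complex.ofReal_ne_zero]; positivity
      simpa using this
    simp only [hx]
    push_cast
    field_simp
    ring

/-- If `w n → 1` quickly enough, then `meanFactor c (w n) (N n) n` behaves as
`n ^ (w n - 1)`. -/
lemma tendsto_meanFactor_mul_exp {c : ℝ} (hc : 0 < c) {w : ℕ → ℂ} {N : ℕ → ℕ}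
    (hN : ∀ᶠ n in atTop, 0 < N n ∧ N n ≤ n) (hw : Tendsto w atTop (𝓝 1))
    (hwN : Tendsto (fun n => ‖1 - w n‖ * (1 + Real.log (N n + 1 + c))) atTop (𝓝 0)) :
    Tendsto (fun n : ℕ => meanFactor c (w n) (N n) n * Complex.exp ((1 - w n) * Real.log n))
      atTop (𝓝 1) := by
  have hw0 : Tendsto (fun n => ‖1 - w n‖) atTop (𝓝 0) := by
    have := (tendsto_const_nhds (x := (1 : ℂ))).sub hw
    simpa using this.norm
  have hsmall : ∀ᶠ n in atTop, ‖1 - w n‖ ≤ 1 / 2 :=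
    hw0.eventually_le_const (by norm_num)
  have hex : ∀ n, ∃ e : ℂ, (0 < N n ∧ N n ≤ n) → ‖1 - w n‖ ≤ 1 / 2 →
      ‖e‖ ≤ ‖1 - w n‖ ^ 2 + ‖1 - w n‖ * (1 + Real.log (N n + 1 + c)) ∧
      meanFactor c (w n) (N n) n * Complex.exp ((1 - w n) * Real.log n) = Complex.exp e := by
    intro n
    by_cases h : (0 < N n ∧ N n ≤ n) ∧ ‖1 - w n‖ ≤ 1 / 2
    · obtain ⟨⟨h1, h2⟩, h3⟩ := h
      obtain ⟨e, he, heq⟩ := exists_meanFactor_eq_exp hc h3 h1 n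
      -- The second correction replaces the shifted harmonic sum by `log n`.
      refine ⟨e - (1 - w n) * ((∑ k ∈ Finset.Ico (N n) n, 1 / ((k : ℝ) + 1 + c)
        - Real.log n : ℝ) : ℂ), fun _ _ => ⟨?_, ?_⟩⟩
      · refine (norm_sub_le _ _).trans (add_le_add he ?_)
        rw [norm_mul, Complex.norm_real]
        gcongr
        exact abs_sum_Ico_sub_log_le hc h1 h2
      · rw [heq, ← Complex.exp_add]
        congr 1
        push_cast
        ring
    · exact ⟨0, fun h1 h2 => absurd ⟨h1, h2⟩ h⟩
  choose e he using hex
  have he0 : Tendsto e atTop (𝓝 0) := by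
    refine squeeze_zero_norm' ?_ (by simpa using (hw0.pow 2).add hwN)
    filter_upwards [hN, hsmall] with n h1 h2 using (he n h1 h2).1
  have h1 : Tendsto (fun n => Complex.exp (e n)) atTop (𝓝 1) := by
    simpa [Function.comp_def] using (Complex.continuous_exp.tendsto 0).comp he0
  refine h1.congr' ?_
  filter_upwards [hN, hsmall] with n h1 h2 using (he n h1 h2).2.symm

end meanFactor

/-! ### Second order expansion of characteristic functions. -/

section taylor

/-- Being valid for every `y`, this crude bound supplies the dominating function; for `|y| ≥ 1` it
is just `2 + |y| ≤ 3 y²`. -/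
lemma Complex.norm_exp_ofReal_mul_I_sub_one_sub_le (y : ℝ) :
    ‖Complex.exp (y * Complex.I) - 1 - y * Complex.I‖ ≤ 3 * y ^ 2 := by
  have hn : ‖(y : ℂ) * Complex.I‖ = |y| := by simp
  rcases le_total |y| 1 with h | h
  · have := Complex.norm_exp_sub_one_sub_id_le (x := y * Complex.I) (by rwa [hn])
    rw [hn, sq_abs] at this
    nlinarith [sq_nonneg y]
  · refine (norm_sub_le _ _).trans ?_
    have h1 := norm_sub_le (Complex.exp (y * Complex.I)) 1
    rw [Complex.norm_exp_ofReal_mul_I, norm_one] at h1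
    rw [hn]
    have : |y| ≤ y ^ 2 := by rw [← sq_abs]; nlinarith
    nlinarith

lemma Complex.norm_exp_ofReal_mul_I_taylor_two_le {y : ℝ} (hy : |y| ≤ 1) :
    ‖Complex.exp (y * Complex.I) - 1 - y * Complex.I + y ^ 2 / 2‖ ≤ |y| ^ 3 := by
  have hn : ‖(y : ℂ) * Complex.I‖ = |y| := by simp
  have := Complex.exp_bound (x := y * Complex.I) (by rwa [hn]) (n := 3) (by norm_num)
  rw [hn] at this
  have h2 : ∑ m ∈ Finset.range 3, ((y : ℂ) * Complex.I) ^ m / (m.factorial : ℂ)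
      = 1 + y * Complex.I - y ^ 2 / 2 := by
    simp [Finset.sum_range_succ, mul_pow, Nat.factorial]
    ring
  rw [h2] at this
  have h3 : |y| ^ 3 * (((3 : ℕ).succ : ℝ) * (((3 : ℕ).factorial : ℝ) * ((3 : ℕ) : ℝ))⁻¹)
      ≤ |y| ^ 3 := by
    refine mul_le_of_le_one_right (by positivity) ?_
    norm_num [Nat.factorial]
  calc _ = ‖Complex.exp (y * Complex.I) - (1 + y * Complex.I - y ^ 2 / 2)‖ := by ring_nf
    _ ≤ _ := this.trans h3

/-- The pointwise limit for dominated convergence: `y n` is of order `1 / √(a n)`, so the cubic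
remainder multiplied by `a n` tends to zero. -/
lemma tendsto_mul_exp_sub_one_sub {a y : ℕ → ℝ} (ha : Tendsto a atTop atTop) {t : ℝ}
    (hy : Tendsto (fun n => √(a n) * y n) atTop (𝓝 t)) :
    Tendsto (fun n => (a n : ℂ) * (Complex.exp (y n * Complex.I) - 1 - y n * Complex.I)) atTop
      (𝓝 (-(t : ℂ) ^ 2 / 2)) := by
  have hsq : Tendsto (fun n => a n * y n ^ 2) atTop (𝓝 (t ^ 2)) := by
    refine (hy.pow 2).congr' ?_
    filter_upwards [ha.eventually_ge_atTop 0] with n hn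
    rw [mul_pow, Real.sq_sqrt hn]
  have hy0 : Tendsto y atTop (𝓝 0) := by
    have h1 : Tendsto (fun n => √(a n)) atTop atTop := Real.tendsto_sqrt_atTop.comp ha
    have h2 := hy.mul h1.inv_tendsto_atTop
    rw [mul_zero] at h2
    refine h2.congr' ?_
    filter_upwards [h1.eventually_gt_atTop 0] with n hn
    simp only [Pi.inv_apply]
    field_simp
  have hrem : Tendsto (fun n => (a n : ℂ) * (Complex.exp (y n * Complex.I) - 1
      - y n * Complex.I + y n ^ 2 / 2)) atTop (𝓝 0) := by
    have h1 : Tendsto (fun n => a n * y n ^ 2 * |y n|) atTop (𝓝 0) := by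
      simpa using hsq.mul hy0.abs
    refine squeeze_zero_norm' ?_ h1
    have h2 : ∀ᶠ n in atTop, |y n| ≤ 1 := by
      have := hy0.abs
      rw [abs_zero] at this
      exact this.eventually_le_const one_pos
    filter_upwards [h2, ha.eventually_ge_atTop 0] with n hn hn0
    rw [norm_mul, Complex.norm_real, Real.norm_of_nonneg hn0]
    calc _ ≤ a n * |y n| ^ 3 := by
          gcongr; exact Complex.norm_exp_ofReal_mul_I_taylor_two_le hn
      _ = _ := by rw [pow_succ, sq_abs]; ring
  have h3 : Tendsto (fun n => ((a n * y n ^ 2 : ℝ) : ℂ)) atTop (𝓝 ((t ^ 2 : ℝ) : ℂ)) :=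
    (Complex.continuous_ofReal.tendsto _).comp hsq
  have h4 := hrem.sub (h3.div_const 2)
  convert h4 using 2
  · push_cast; ring
  · push_cast; ring

variable {E : Type*} [NormedAddCommGroup E] [InnerProductSpace ℝ E] [CompleteSpace E]
  [MeasurableSpace E] [BorelSpace E]

/-- Second order expansion of a characteristic function at the origin. -/
lemma tendsto_mul_charFun_sub_one_sub {ρ : Measure E} [IsProbabilityMeasure ρ]
    (hρ : Integrable (fun x => ‖x‖ ^ 2) ρ) (hρ1 : Integrable id ρ) {a : ℕ → ℝ}
    (ha : Tendsto a atTop atTop) {s : ℕ → E} {θ : E}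
    (hs : Tendsto (fun n => √(a n) • s n) atTop (𝓝 θ)) :
    Tendsto (fun n => (a n : ℂ) * (charFun ρ (s n) - 1
      - (inner ℝ (∫ x, x ∂ρ) (s n) : ℝ) * Complex.I)) atTop
      (𝓝 (-((∫ x, inner ℝ x θ ^ 2 ∂ρ : ℝ) : ℂ) / 2)) := by
  have hin : ∀ v : E, Integrable (fun x => inner ℝ x v) ρ := fun v => hρ1.inner_const v
  have heq : ∀ n, (a n : ℂ) * (charFun ρ (s n) - 1 - (inner ℝ (∫ x, x ∂ρ) (s n) : ℝ) * Complex.I)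
      = ∫ x, (a n : ℂ) * (Complex.exp ((inner ℝ x (s n) : ℝ) * Complex.I) - 1
        - (inner ℝ x (s n) : ℝ) * Complex.I) ∂ρ := by
    intro n
    have hE : Integrable (fun x => Complex.exp ((inner ℝ x (s n) : ℝ) * Complex.I)) ρ :=
      .of_bound (by fun_prop : Continuous _).aestronglyMeasurable 1
        (ae_of_all _ fun x => (Complex.norm_exp_ofReal_mul_I _).le)
    have hI : Integrable (fun x => ((inner ℝ x (s n) : ℝ) : ℂ) * Complex.I) ρ :=
      (hin (s n)).ofReal.mul_const _
    have hm : ∫ x, inner ℝ x (s n) ∂ρ = inner ℝ (∫ x, x ∂ρ) (s n) := by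
      rw [real_inner_comm, ← integral_inner (f := fun x => x) hρ1]
      simp only [real_inner_comm]
    have hE1 : Integrable (fun x => Complex.exp ((inner ℝ x (s n) : ℝ) * Complex.I) - 1) ρ :=
      hE.sub (integrable_const _)
    rw [integral_const_mul, integral_sub hE1 hI,
      integral_sub hE (integrable_const _), integral_mul_const, integral_complex_ofReal,
      charFun_apply, hm]
    simp
  simp only [heq]
  have hlim : -((∫ x, inner ℝ x θ ^ 2 ∂ρ : ℝ) : ℂ) / 2
      = ∫ x, -((inner ℝ x θ : ℝ) : ℂ) ^ 2 / 2 ∂ρ := by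
    rw [integral_div, integral_neg, ← integral_complex_ofReal]
    simp only [Complex.ofReal_pow]
  rw [hlim]
  have hb : ∀ᶠ n in atTop, ‖√(a n) • s n‖ ≤ ‖θ‖ + 1 :=
    hs.norm.eventually_le_const (by linarith)
  refine tendsto_integral_filter_of_dominated_convergence
    (fun x => 3 * (‖θ‖ + 1) ^ 2 * ‖x‖ ^ 2)
    (.of_forall fun n => (by fun_prop : Continuous _).aestronglyMeasurable) ?_
    (hρ.const_mul _) (ae_of_all _ fun x => ?_)
  · filter_upwards [hb, ha.eventually_ge_atTop 0] with n hn hn0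
    refine ae_of_all _ fun x => ?_
    rw [norm_mul, Complex.norm_real, Real.norm_of_nonneg hn0]
    have h1 : (inner ℝ x (s n)) ^ 2 ≤ (‖x‖ * ‖s n‖) ^ 2 := by
      rw [← sq_abs]
      gcongr
      exact abs_real_inner_le_norm _ _
    have h2 : a n * ‖s n‖ ^ 2 ≤ (‖θ‖ + 1) ^ 2 := by
      calc a n * ‖s n‖ ^ 2 = ‖√(a n) • s n‖ ^ 2 := by
            rw [norm_smul, mul_pow, Real.norm_of_nonneg (Real.sqrt_nonneg _), Real.sq_sqrt hn0]
        _ ≤ _ := by gcongr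
    calc _ ≤ a n * (3 * (‖x‖ * ‖s n‖) ^ 2) := by
          gcongr
          exact (Complex.norm_exp_ofReal_mul_I_sub_one_sub_le _).trans (by gcongr)
      _ = 3 * (a n * ‖s n‖ ^ 2) * ‖x‖ ^ 2 := by ring
      _ ≤ _ := by gcongr
  · refine tendsto_mul_exp_sub_one_sub ha ?_
    have := (tendsto_const_nhds (x := x)).inner hs (𝕜 := ℝ)
    simpa only [inner_smul_right] using this

end taylor

/-! ### Modulus of continuity of the normalised Fourier transform. -/

section fourierComparison

variable {E : Type*} [NormedAddCommGroup E] [InnerProductSpace ℝ E] [MeasurableSpace E]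
  [BorelSpace E]

omit [MeasurableSpace E] [BorelSpace E] in
-- Beyond distance `r` the difference is at most `2`; within distance `r` the exponential is
-- Lipschitz in the phase. Integrated, this turns smallness of `truncMean` into closeness of Fourier
-- transforms at frequencies `O(1 / r)` apart.
lemma norm_exp_inner_sub_le {r : ℝ} (hr : 0 < r) (x s t : E) :
    ‖Complex.exp ((inner ℝ x s : ℝ) * Complex.I) - Complex.exp ((inner ℝ x t : ℝ) * Complex.I)‖
      ≤ (2 + ‖s - t‖ * r) * min 1 (‖x‖ / r) := by
  rcases le_total r ‖x‖ with h | h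
  · rw [min_eq_left ((one_le_div hr).2 h), mul_one]
    refine (norm_sub_le _ _).trans ?_
    rw [Complex.norm_exp_ofReal_mul_I, Complex.norm_exp_ofReal_mul_I]
    have : 0 ≤ ‖s - t‖ * r := by positivity
    linarith
  · rw [min_eq_right ((div_le_one hr).2 h)]
    have h1 : Complex.exp ((inner ℝ x s : ℝ) * Complex.I)
        - Complex.exp ((inner ℝ x t : ℝ) * Complex.I)
        = Complex.exp ((inner ℝ x t : ℝ) * Complex.I)
          * (Complex.exp (Complex.I * (inner ℝ x (s - t) : ℝ)) - 1) := by
      rw [mul_sub, ← Complex.exp_add, inner_sub_right, mul_one]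
      congr 2
      push_cast
      ring
    rw [h1, norm_mul, Complex.norm_exp_ofReal_mul_I, one_mul]
    refine Real.norm_exp_I_mul_ofReal_sub_one_le.trans ?_
    rw [Real.norm_eq_abs]
    refine (abs_real_inner_le_norm _ _).trans ?_
    have h2 : 0 ≤ ‖x‖ / r := by positivity
    calc ‖x‖ * ‖s - t‖ = (‖s - t‖ * r) * (‖x‖ / r) := by field_simp
      _ ≤ _ := by nlinarith

variable {Ω : Type*} {M₀ : FiniteMeasure E} {M : ℕ → Ω → FiniteMeasure E}

lemma norm_normCharFun_sub_le (hM₀ : 0 < M₀.mass) {r : ℝ} (hr : 0 < r) (n : ℕ) (s t : E) (ω : Ω) :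
    ‖normCharFun M₀ M n s ω - normCharFun M₀ M n t ω‖
      ≤ (2 + ‖s - t‖ * r) * truncMean M₀ M r n ω := by
  have hn : (0 : ℝ) < n + M₀.mass := by positivity
  have hi : ∀ v : E, Integrable (fun x => Complex.exp ((inner ℝ x v : ℝ) * Complex.I))
      (M n ω : Measure E) := fun v =>
    .of_bound (by fun_prop : Continuous _).aestronglyMeasurable 1
      (ae_of_all _ fun x => (Complex.norm_exp_ofReal_mul_I _).le)
  rw [normCharFun, normCharFun, ← sub_div, norm_div, Complex.norm_real, Real.norm_of_nonneg hn.le,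
    charFun_apply, charFun_apply, ← integral_sub (hi s) (hi t), truncMean, div_eq_inv_mul,
    mul_left_comm]
  gcongr
  rw [← integral_const_mul]
  refine (norm_integral_le_integral_norm _).trans ?_
  refine integral_mono ((hi s).sub (hi t)).norm
    (.of_bound (C := 2 + ‖s - t‖ * r) (by fun_prop : Measurable _).aestronglyMeasurable
      (ae_of_all _ fun x => ?_)) fun x => norm_exp_inner_sub_le hr x s t
  rw [norm_mul, Real.norm_of_nonneg (by positivity)]
  exact mul_le_of_le_one_right (by positivity) (norm_truncation_le hr x)

omit [BorelSpace E] in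
lemma normCharFun_zero {mΩ : MeasurableSpace Ω} {μ : Measure Ω} {R : Kernel E E} [IsMarkovKernel R]
    {ℱ : Filtration ℕ mΩ} {C : ℕ → Ω → E} (h : IsPolyaScheme μ M₀ R M ℱ C) (hM₀ : 0 < M₀.mass)
    (n : ℕ) (ω : Ω) : normCharFun M₀ M n 0 ω = 1 := by
  have hn : (0 : ℝ) < n + M₀.mass := by positivity
  rw [normCharFun, charFun_zero, h.real_univ_eq]
  exact div_self (by rw [Complex.ofReal_ne_zero]; exact hn.ne')

end fourierComparison

/-! ### Compatibility of the truncation radius with the polylogarithmic time. -/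

section scales

/-- The truncation radius at time `n`. -/
noncomputable def truncRadius (n : ℕ) : ℝ := ((n : ℝ) + 1) ^ (1 / 8 : ℝ)

/-- A time that is polylogarithmic in `n`. -/
noncomputable def logTime (n : ℕ) : ℕ := ⌈Real.log n⌉₊ ^ 4

lemma truncRadius_pos (n : ℕ) : 0 < truncRadius n := by unfold truncRadius; positivity

lemma truncRadius_le (n : ℕ) : truncRadius n ≤ n + 1 := by
  have : (1 : ℝ) ≤ n + 1 := by linarith [(Nat.cast_nonneg n : (0 : ℝ) ≤ n)]
  calc _ ≤ ((n : ℝ) + 1) ^ (1 : ℝ) := Real.rpow_le_rpow_of_exponent_le this (by norm_num)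
    _ = _ := Real.rpow_one _

lemma truncRadius_mono : Monotone truncRadius := by
  intro a b hab
  unfold truncRadius
  have : (a : ℝ) ≤ b := by exact_mod_cast hab
  gcongr

lemma tendsto_natCast_add_one : Tendsto (fun n : ℕ => (n : ℝ) + 1) atTop atTop :=
  tendsto_atTop_add_const_right _ _ tendsto_natCast_atTop_atTop

lemma tendsto_truncRadius : Tendsto truncRadius atTop atTop :=
  (tendsto_rpow_atTop (by norm_num)).comp tendsto_natCast_add_one

lemma summable_truncRadius :
    Summable fun n : ℕ => 1 / truncRadius n * (1 / ((n : ℝ) + 1)) := by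
  have h1 : Summable fun n : ℕ => ((n : ℝ) ^ (9 / 8 : ℝ))⁻¹ :=
    Real.summable_nat_rpow_inv.2 (by norm_num)
  refine ((summable_nat_add_iff 1).2 h1).congr fun n => ?_
  have : (0 : ℝ) < n + 1 := by positivity
  have h2 : ((n : ℝ) + 1) ^ (9 / 8 : ℝ) = ((n : ℝ) + 1) ^ (1 / 8 : ℝ) * (n + 1) := by
    rw [← Real.rpow_add_one this.ne']
    norm_num
  rw [truncRadius, Nat.cast_add, Nat.cast_one, h2, mul_inv, ← one_div, ← one_div]

lemma tendsto_harmonic_div_truncRadius :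
    Tendsto (fun n => 1 / truncRadius n * ∑ k ∈ Finset.range n, 1 / ((k : ℝ) + 1)) atTop (𝓝 0) := by
  have h1 : Tendsto (fun x : ℝ => Real.log x / x ^ (1 / 8 : ℝ)) atTop (𝓝 0) :=
    (isLittleO_log_rpow_atTop (by norm_num)).tendsto_div_nhds_zero
  have h2 := (h1.comp tendsto_natCast_add_one).add (tendsto_truncRadius.const_div_atTop 1)
  rw [add_zero] at h2
  refine squeeze_zero (fun n => ?_) (fun n => ?_) h2
  · have := truncRadius_pos n
    positivity
  · have := truncRadius_pos n
    simp only [Function.comp_apply]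
    rw [← truncRadius, ← add_div, one_div, ← div_eq_inv_mul]
    gcongr
    refine (sum_range_one_div_le n).trans ?_
    rw [add_comm]
    rcases Nat.eq_zero_or_pos n with rfl | hn
    · simp
    · gcongr
      linarith

lemma tendsto_log_natCast : Tendsto (fun n : ℕ => Real.log n) atTop atTop :=
  Real.tendsto_log_atTop.comp tendsto_natCast_atTop_atTop

lemma tendsto_ceil_log : Tendsto (fun n : ℕ => ⌈Real.log n⌉₊) atTop atTop :=
  tendsto_nat_ceil_atTop.comp tendsto_log_natCast

lemma tendsto_logTime : Tendsto logTime atTop atTop :=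
  (tendsto_pow_atTop (by norm_num)).comp tendsto_ceil_log

lemma logTime_le_pow {n : ℕ} (hn : 1 ≤ Real.log n) : (logTime n : ℝ) ≤ (2 * Real.log n) ^ 4 := by
  rw [logTime, Nat.cast_pow]
  gcongr
  linarith [(Nat.ceil_lt_add_one (by linarith : 0 ≤ Real.log n)).le]

lemma eventually_logTime_le : ∀ᶠ n in atTop, logTime n ≤ n := by
  have h1 : Tendsto (fun x : ℝ => Real.log x ^ 4 / x) atTop (𝓝 0) := by
    simpa using Real.tendsto_pow_log_div_mul_add_atTop 1 0 4 one_ne_zero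
  have h2 := (h1.comp tendsto_natCast_atTop_atTop).eventually_le_const
    (by norm_num : (0 : ℝ) < 1 / 16)
  filter_upwards [h2, tendsto_log_natCast.eventually_ge_atTop 1, eventually_gt_atTop 0]
    with n hn hn1 hn0
  have hn0' : (0 : ℝ) < n := by exact_mod_cast hn0
  have h3 := logTime_le_pow hn1
  simp only [Function.comp_apply] at hn
  rw [div_le_iff₀ hn0'] at hn
  have : (logTime n : ℝ) ≤ n := by nlinarith
  exact_mod_cast this

/-- The exponents are matched: `4 · (1/8) = 1/2`. Frequencies of order `1 / √(log n)` are thus at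
most of the order of the inverse truncation radius at time `logTime n`. -/
lemma truncRadius_logTime_le {n : ℕ} (hn : 1 ≤ Real.log n) :
    truncRadius (logTime n) ≤ 2 * √(Real.log n) := by
  have h1 := logTime_le_pow hn
  have h2 : (logTime n : ℝ) + 1 ≤ (4 * Real.log n) ^ 4 := by
    have : (1 : ℝ) ≤ Real.log n ^ 4 := one_le_pow₀ hn
    nlinarith
  calc truncRadius (logTime n) ≤ ((4 * Real.log n) ^ 4) ^ (1 / 8 : ℝ) := by
        unfold truncRadius; gcongr
    _ = √(4 * Real.log n) := by
        rw [← Real.rpow_natCast, ← Real.rpow_mul (by positivity), Real.sqrt_eq_rpow]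
        norm_num
    _ = _ := by
        rw [Real.sqrt_mul (by norm_num), show (4 : ℝ) = 2 ^ 2 by norm_num,
          Real.sqrt_sq (by norm_num)]

/-- The logarithm of a polylogarithmic time is `O(log log n)`. Since `1 - w` will be `O(1 / √(log
n))`, starting the product at `logTime n` does not affect its limit. -/
lemma tendsto_log_logTime_div {c : ℝ} (hc : 0 ≤ c) :
    Tendsto (fun n : ℕ => (1 + Real.log (logTime n + 1 + c)) / √(Real.log n)) atTop (𝓝 0) := by
  have h1 : Tendsto (fun x : ℝ => Real.log x / x ^ (1 / 2 : ℝ)) atTop (𝓝 0) :=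
    (isLittleO_log_rpow_atTop (by norm_num)).tendsto_div_nhds_zero
  have h2 := (h1.comp tendsto_log_natCast).const_mul 4
  have h3 : Tendsto (fun n : ℕ => √(Real.log n)) atTop atTop :=
    Real.tendsto_sqrt_atTop.comp tendsto_log_natCast
  have h4 := h2.add (h3.const_div_atTop (1 + Real.log (17 + c)))
  rw [mul_zero, add_zero] at h4
  refine squeeze_zero' (.of_forall fun n => ?_) ?_ h4
  · have : 0 ≤ Real.log (logTime n + 1 + c) :=
      Real.log_nonneg (by linarith [(Nat.cast_nonneg (logTime n) : (0 : ℝ) ≤ logTime n)])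
    positivity
  · filter_upwards [tendsto_log_natCast.eventually_ge_atTop 1] with n hn
    have hl := logTime_le_pow hn
    have hx : (0 : ℝ) < Real.log n := by linarith
    simp only [Function.comp_apply]
    rw [← Real.sqrt_eq_rpow, ← mul_div_assoc, ← add_div]
    refine div_le_div_of_nonneg_right ?_ (Real.sqrt_nonneg _)
    -- The constant is `2⁴ + 1 + c`, with `2⁴` from `logTime_le_pow`.
    have h5 : (logTime n : ℝ) + 1 + c ≤ (17 + c) * Real.log n ^ 4 := by
      have : (1 : ℝ) ≤ Real.log n ^ 4 := one_le_pow₀ hn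
      nlinarith
    have h6 := Real.log_le_log (by positivity) h5
    rw [Real.log_mul (by positivity) (by positivity), Real.log_pow] at h6
    push_cast at h6
    linarith

end scales

/-! ### A fine lattice of frequencies. -/

section grid

variable {d : ℕ}

/-- The point of the lattice of mesh `1 / (n + 1)` with integer coordinates `z`. -/
noncomputable def latticePoint (n : ℕ) (z : Fin d → ℤ) : EuclideanSpace ℝ (Fin d) :=
  WithLp.toLp 2 fun i => (z i : ℝ) / (n + 1)

/-- The integer coordinates of the lattice points in the cube `[-1, 1]^d`. -/
noncomputable def latticeCube (d n : ℕ) : Finset (Fin d → ℤ) :=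
  Fintype.piFinset fun _ => Finset.Icc (-((n : ℤ) + 1)) (n + 1)

lemma card_latticeCube (n : ℕ) : (latticeCube d n).card = (2 * n + 3) ^ d := by
  rw [latticeCube, Fintype.card_piFinset]
  simp only [Int.card_Icc, Finset.prod_const, Finset.card_univ, Fintype.card_fin]
  congr 1
  omega

/-- Rounding to the lattice. -/
noncomputable def latticeRound (n : ℕ) (s : EuclideanSpace ℝ (Fin d)) : Fin d → ℤ :=
  fun i => ⌊s i * (n + 1)⌋

lemma latticeRound_mem {n : ℕ} {s : EuclideanSpace ℝ (Fin d)} (hs : ‖s‖ ≤ 1) :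
    latticeRound n s ∈ latticeCube d n := by
  rw [latticeCube, Fintype.mem_piFinset]
  intro i
  have hi : |s i| ≤ 1 := by
    have := PiLp.norm_apply_le s i
    rw [Real.norm_eq_abs] at this
    exact this.trans hs
  obtain ⟨h1, h2⟩ := abs_le.1 hi
  have hn : (0 : ℝ) < n + 1 := by positivity
  rw [Finset.mem_Icc, latticeRound]
  constructor
  · rw [Int.le_floor]
    push_cast
    nlinarith
  · have : (⌊s i * (n + 1)⌋ : ℝ) ≤ n + 1 := (Int.floor_le _).trans (by nlinarith)
    exact_mod_cast this

lemma norm_sub_latticePoint_le (n : ℕ) (s : EuclideanSpace ℝ (Fin d)) :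
    ‖s - latticePoint n (latticeRound n s)‖ ≤ d / (n + 1) := by
  have hn : (0 : ℝ) < n + 1 := by positivity
  have hcoord : ∀ i, |(s - latticePoint n (latticeRound n s)) i| ≤ 1 / (n + 1) := by
    intro i
    have h1 := Int.floor_le (s i * ((n : ℝ) + 1))
    have h2 := Int.lt_floor_add_one (s i * ((n : ℝ) + 1))
    have h3 : (s - latticePoint n (latticeRound n s)) i
        = (s i * (n + 1) - ⌊s i * ((n : ℝ) + 1)⌋) / (n + 1) := by
      simp only [PiLp.sub_apply, latticePoint, latticeRound]
      field_simp
    rw [h3, abs_div, abs_of_pos hn, abs_of_nonneg (by linarith)]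
    gcongr
    linarith
  have h4 : ‖s - latticePoint n (latticeRound n s)‖
      ≤ ∑ i, |(s - latticePoint n (latticeRound n s)) i| := by
    rw [EuclideanSpace.norm_eq]
    refine Real.sqrt_le_iff.2 ⟨Finset.sum_nonneg fun i _ => abs_nonneg _, ?_⟩
    simp only [Real.norm_eq_abs]
    exact Finset.sum_sq_le_sq_sum_of_nonneg fun i _ => abs_nonneg _
  refine h4.trans ((Finset.sum_le_sum fun i _ => hcoord i).trans (le_of_eq ?_))
  simp [div_eq_mul_inv]

end grid

/-! ### Concentration uniformly over the lattice. -/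

section uniform

variable {d : ℕ} {Ω : Type*} {mΩ : MeasurableSpace Ω} {μ : Measure Ω}
  {M₀ : FiniteMeasure (EuclideanSpace ℝ (Fin d))}
  {R : Kernel (EuclideanSpace ℝ (Fin d)) (EuclideanSpace ℝ (Fin d))}
  {M : ℕ → Ω → FiniteMeasure (EuclideanSpace ℝ (Fin d))}
  {ℱ : Filtration ℕ mΩ} {C : ℕ → Ω → EuclideanSpace ℝ (Fin d)}

/-- The exponent is of order `(log n)²`: once `(ε / 2) log n ≥ d + 2`, the exponential is at most a
constant times `n^{-(d+2)}`, which absorbs the `(2n + 3)^d` lattice points and leaves a summable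
`n^{-2}`. -/
lemma eventually_lattice_bound (d : ℕ) {ε : ℝ} (hε : 0 < ε) :
    ∀ᶠ n : ℕ in atTop, (2 * (n : ℝ) + 3) ^ d
        * (4 * Real.exp (4 - (⌈Real.log n⌉₊ : ℝ) ^ 2 * (ε / 2)))
      ≤ 4 * Real.exp 4 * 5 ^ d * (1 / (n : ℝ) ^ 2) := by
  filter_upwards [eventually_ge_atTop 1, tendsto_log_natCast.eventually_ge_atTop
    ((d + 2) / (ε / 2))] with n hn hlog
  have hn1 : (1 : ℝ) ≤ n := by exact_mod_cast hn
  have hn0 : (0 : ℝ) < n := by linarith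
  have hL : Real.log n ≤ ⌈Real.log n⌉₊ := Nat.le_ceil _
  have hlog0 : 0 ≤ Real.log n := Real.log_nonneg hn1
  rw [div_le_iff₀ (by positivity)] at hlog
  have h1 : ((d : ℝ) + 2) * Real.log n ≤ (⌈Real.log n⌉₊ : ℝ) ^ 2 * (ε / 2) := by
    calc ((d : ℝ) + 2) * Real.log n ≤ (Real.log n * (ε / 2)) * Real.log n := by gcongr
      _ = Real.log n ^ 2 * (ε / 2) := by ring
      _ ≤ _ := by gcongr
  have h2 : Real.exp (4 - (⌈Real.log n⌉₊ : ℝ) ^ 2 * (ε / 2))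
      ≤ Real.exp 4 * (1 / (n : ℝ) ^ (d + 2)) := by
    calc _ ≤ Real.exp (4 + -(((d : ℝ) + 2) * Real.log n)) := by
          rw [Real.exp_le_exp]; linarith
      _ = _ := by
          rw [Real.exp_add, Real.exp_neg, one_div]
          congr 2
          rw [← Real.exp_log (pow_pos hn0 (d + 2)), Real.log_pow]
          push_cast
          rfl
  calc _ ≤ (5 * (n : ℝ)) ^ d * (4 * (Real.exp 4 * (1 / (n : ℝ) ^ (d + 2)))) := by
        gcongr; linarith
    _ = _ := by
        rw [mul_pow, pow_add]
        field_simp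

/-- Uniformly over a fine lattice, the normalised Fourier transform at time `n` is close to
its conditional mean given a polylogarithmic time. -/
lemma IsPolyaScheme.ae_eventually_lattice [IsProbabilityMeasure μ] [IsMarkovKernel R]
    (h : IsPolyaScheme μ M₀ R M ℱ C) (hM₀ : 0 < M₀.mass)
    {w : EuclideanSpace ℝ (Fin d) → ℂ}
    (hw : ∀ s x, charFun (R x) s = Complex.exp (inner ℝ x s * Complex.I) * w s)
    (hw1 : ∀ s, ‖w s‖ ≤ 1) {ε : ℝ} (hε : 0 < ε) :
    ∀ᵐ ω ∂μ, ∀ᶠ n in atTop, ∀ z ∈ latticeCube d n,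
      ‖normCharFun M₀ M n (latticePoint n z) ω
        - meanFactor M₀.mass (w (latticePoint n z)) (logTime n) n
          * normCharFun M₀ M (logTime n) (latticePoint n z) ω‖ < ε := by
  set A : ℕ → Set Ω := fun n => ⋃ z ∈ latticeCube d n,
    {ω | ε ≤ ‖normCharFun M₀ M n (latticePoint n z) ω
        - meanFactor M₀.mass (w (latticePoint n z)) (logTime n) n
          * normCharFun M₀ M (logTime n) (latticePoint n z) ω‖} with hA
  have hbound : ∀ᶠ n in atTop, ‖μ.real (A n)‖ ≤ 4 * Real.exp 4 * 5 ^ d * (1 / (n : ℝ) ^ 2) := by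
    filter_upwards [eventually_lattice_bound d hε, eventually_logTime_le,
      tendsto_ceil_log.eventually_ge_atTop 2] with n h1 h2 h3
    refine le_trans ?_ h1
    rw [Real.norm_of_nonneg measureReal_nonneg]
    have hL : (2 : ℝ) ≤ ⌈Real.log n⌉₊ := by exact_mod_cast h3
    have hN : ((logTime n : ℕ) : ℝ) = (⌈Real.log n⌉₊ : ℝ) ^ 4 := by rw [logTime, Nat.cast_pow]
    have hN0 : 0 < logTime n := by unfold logTime; positivity
    refine (measureReal_biUnion_finset_le _ _).trans ?_
    calc _ ≤ ∑ z ∈ latticeCube d n, 4 * Real.exp (4 - (⌈Real.log n⌉₊ : ℝ) ^ 2 * (ε / 2)) := by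
          refine Finset.sum_le_sum fun z _ => ?_
          -- With `L = ⌈log n⌉`, `N = L⁴` and `a = L²`, the variance term `4 a² / N` is the constant
          -- `4`; `2 a ≤ N` holds as soon as `L ≥ 2`.
          refine (h.measureReal_normCharFun_sub_ge_le hM₀ (hw _) (hw1 _) hN0 h2
            (a := (⌈Real.log n⌉₊ : ℝ) ^ 2) (by positivity) ?_ ε).trans (le_of_eq ?_)
          · rw [hN]
            have : (4 : ℝ) ≤ (⌈Real.log n⌉₊ : ℝ) ^ 2 := by nlinarith
            nlinarith
          · rw [hN, ← pow_mul, mul_div_assoc, div_self (by positivity), mul_one]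
      _ = _ := by
          rw [Finset.sum_const, card_latticeCube, nsmul_eq_mul]
          push_cast
          rfl
  have hsum : Summable fun n => μ.real (A n) := by
    refine Summable.of_norm_bounded_eventually_nat
      ((Real.summable_one_div_nat_pow.2 one_lt_two).mul_left _) hbound
  have hne : ∑' n, μ (A n) ≠ ∞ := by
    refine (tsum_congr fun n => ?_).trans_ne hsum.tsum_ofReal_ne_top
    exact (ofReal_measureReal (measure_ne_top _ _)).symm
  filter_upwards [ae_eventually_notMem hne] with ω hω
  filter_upwards [hω] with n hn z hz
  by_contra hcon
  exact hn (Set.mem_biUnion hz (not_lt.1 hcon))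

end uniform

/-! ### Pointwise limit of the centred Fourier transform. -/

section limit

variable {d : ℕ} {Ω : Type*} {mΩ : MeasurableSpace Ω} {μ : Measure Ω}
  {M₀ : FiniteMeasure (EuclideanSpace ℝ (Fin d))}
  {R : Kernel (EuclideanSpace ℝ (Fin d)) (EuclideanSpace ℝ (Fin d))}
  {M : ℕ → Ω → FiniteMeasure (EuclideanSpace ℝ (Fin d))}
  {ℱ : Filtration ℕ mΩ} {C : ℕ → Ω → EuclideanSpace ℝ (Fin d)}

lemma tendsto_log_mul_div :
    Tendsto (fun n : ℕ => Real.log n * (d / ((n : ℝ) + 1))) atTop (𝓝 0) := by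
  have h1 : Tendsto (fun x : ℝ => Real.log x / x) atTop (𝓝 0) :=
    (Real.isLittleO_log_id_atTop).tendsto_div_nhds_zero
  have h2 := (h1.comp tendsto_natCast_atTop_atTop).const_mul (d : ℝ)
  rw [mul_zero] at h2
  refine squeeze_zero' ?_ ?_ h2
  · filter_upwards [tendsto_log_natCast.eventually_ge_atTop 0] with n hn
    positivity
  · filter_upwards [tendsto_log_natCast.eventually_ge_atTop 0, eventually_gt_atTop 0] with n hn hn0
    have : (0 : ℝ) < n := by exact_mod_cast hn0
    simp only [Function.comp_apply]
    calc Real.log n * (d / ((n : ℝ) + 1)) ≤ Real.log n * (d / n) := by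
          gcongr; linarith
      _ = _ := by ring

/-- `√(log n) (1 - charFun ρ (s n))` converges when `√(log n) • s n` does. -/
lemma tendsto_sqrt_mul_one_sub_charFun {ρ : Measure (EuclideanSpace ℝ (Fin d))}
    [IsProbabilityMeasure ρ] (hρ : Integrable (fun x => ‖x‖ ^ 2) ρ) (hρ1 : Integrable id ρ)
    {a : ℕ → ℝ} (ha : Tendsto a atTop atTop)
    {s : ℕ → EuclideanSpace ℝ (Fin d)} {θ : EuclideanSpace ℝ (Fin d)}
    (hs : Tendsto (fun n => √(a n) • s n) atTop (𝓝 θ)) :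
    Tendsto (fun n => (√(a n) : ℂ) * (1 - charFun ρ (s n))) atTop
      (𝓝 (-((inner ℝ (∫ x, x ∂ρ) θ : ℝ) * Complex.I))) := by
  have hsq : Tendsto (fun n => √(a n)) atTop atTop := Real.tendsto_sqrt_atTop.comp ha
  have h1 := tendsto_mul_charFun_sub_one_sub hρ hρ1 ha hs
  have h2 : Tendsto (fun n => (((√(a n))⁻¹ : ℝ) : ℂ)) atTop (𝓝 ((0 : ℝ) : ℂ)) :=
    (Complex.continuous_ofReal.tendsto _).comp hsq.inv_tendsto_atTop
  have h3 : Tendsto (fun n => ((inner ℝ (∫ x, x ∂ρ) (√(a n) • s n) : ℝ) : ℂ) * Complex.I) atTop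
      (𝓝 ((inner ℝ (∫ x, x ∂ρ) θ : ℝ) * Complex.I)) :=
    ((Complex.continuous_ofReal.tendsto _).comp
      ((tendsto_const_nhds (x := ∫ x, x ∂ρ)).inner hs (𝕜 := ℝ))).mul_const _
  have h4 := (h2.mul h1).add h3
  -- At scale `√(a n)` the quadratic term disappears and only the mean contributes.
  rw [Complex.ofReal_zero, zero_mul, zero_add] at h4
  refine h4.neg.congr' ?_
  filter_upwards [ha.eventually_gt_atTop 0] with n hn
  have h5 : ((a n : ℝ) : ℂ) = (√(a n) : ℂ) * (√(a n) : ℂ) := by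
    rw [← Complex.ofReal_mul, Real.mul_self_sqrt hn.le]
  have h6 : (√(a n) : ℂ) ≠ 0 := by
    rw [Complex.ofReal_ne_zero]; exact (Real.sqrt_pos.2 hn).ne'
  rw [h5, inner_smul_right]
  push_cast
  field_simp
  ring

/-- Asymptotics of the conditional mean of the normalised Fourier transform. -/
lemma tendsto_meanFactor_charFun {ρ : Measure (EuclideanSpace ℝ (Fin d))}
    [IsProbabilityMeasure ρ] (hρ : Integrable (fun x => ‖x‖ ^ 2) ρ) (hρ1 : Integrable id ρ)
    {c : ℝ} (hc : 0 < c) {s : ℕ → EuclideanSpace ℝ (Fin d)} {θ : EuclideanSpace ℝ (Fin d)}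
    (hs : Tendsto (fun n : ℕ => √(Real.log n) • s n) atTop (𝓝 θ)) :
    Tendsto (fun n : ℕ => meanFactor c (charFun ρ (s n)) (logTime n) n
      * Complex.exp (-((Real.log n * inner ℝ (∫ x, x ∂ρ) (s n) : ℝ) * Complex.I))) atTop
      (𝓝 (Complex.exp (-((∫ x, inner ℝ x θ ^ 2 ∂ρ : ℝ) : ℂ) / 2))) := by
  have ha := tendsto_log_natCast
  have hsq : Tendsto (fun n : ℕ => √(Real.log n)) atTop atTop := Real.tendsto_sqrt_atTop.comp ha
  have h1 := tendsto_sqrt_mul_one_sub_charFun hρ hρ1 ha hs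
  have hw : Tendsto (fun n => charFun ρ (s n)) atTop (𝓝 1) := by
    have h2 : Tendsto (fun n : ℕ => (((√(Real.log n))⁻¹ : ℝ) : ℂ)) atTop (𝓝 ((0 : ℝ) : ℂ)) :=
      (Complex.continuous_ofReal.tendsto _).comp hsq.inv_tendsto_atTop
    have h3 := (tendsto_const_nhds (x := (1 : ℂ))).sub (h2.mul h1)
    rw [Complex.ofReal_zero, zero_mul, sub_zero] at h3
    refine h3.congr' ?_
    filter_upwards [hsq.eventually_gt_atTop 0] with n hn
    have : (√(Real.log n) : ℂ) ≠ 0 := by rw [Complex.ofReal_ne_zero]; exact hn.ne'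
    push_cast
    field_simp
    ring
  have hwN : Tendsto (fun n : ℕ => ‖1 - charFun ρ (s n)‖ * (1 + Real.log (logTime n + 1 + c)))
      atTop (𝓝 0) := by
    have h2 := h1.norm.mul (tendsto_log_logTime_div hc.le)
    rw [mul_zero] at h2
    refine h2.congr' ?_
    filter_upwards [hsq.eventually_gt_atTop 0] with n hn
    rw [norm_mul, Complex.norm_real, Real.norm_of_nonneg hn.le]
    field_simp
  have hN : ∀ᶠ n in atTop, 0 < logTime n ∧ logTime n ≤ n :=
    (tendsto_logTime.eventually_gt_atTop 0).and eventually_logTime_le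
  have h4 := tendsto_meanFactor_mul_exp hc hN hw hwN
  have h5 := (Complex.continuous_exp.tendsto _).comp
    (tendsto_mul_charFun_sub_one_sub hρ hρ1 ha hs)
  -- The factors `exp ((1 - w) log n)` and `exp ((w - 1) log n - i log n ⟨m, s⟩)` multiply to the
  -- centring phase alone.
  have h6 := h4.mul h5
  rw [one_mul] at h6
  refine h6.congr fun n => ?_
  simp only [Function.comp_apply]
  rw [mul_assoc, ← Complex.exp_add]
  congr 2
  push_cast
  ring

/-- The argument is deterministic along a fixed `ω`, so a single null set serves all `θ`. With `s`
rounded to the lattice point `t`, `N = logTime n`, `Q` the mean factor and `u`, `v` the centring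
phases at `s`, `t`, one splits `Y_n(s) u` into `(Y_n(s) - Y_n(t)) u`, `(Y_n(t) - Q Y_N(t)) u` and
`(Q v)(u / v) Y_N(t)`. -/
lemma IsPolyaScheme.tendsto_normCharFun [IsMarkovKernel R]
    (h : IsPolyaScheme μ M₀ R M ℱ C) (hM₀ : 0 < M₀.mass)
    {ρ : Measure (EuclideanSpace ℝ (Fin d))}
    [IsProbabilityMeasure ρ] (hρ : Integrable (fun x => ‖x‖ ^ 2) ρ) (hρ1 : Integrable id ρ) {ω : Ω}
    (hlat : ∀ q : ℕ, ∀ᶠ n in atTop, ∀ z ∈ latticeCube d n,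
      ‖normCharFun M₀ M n (latticePoint n z) ω
        - meanFactor M₀.mass (charFun ρ (latticePoint n z)) (logTime n) n
          * normCharFun M₀ M (logTime n) (latticePoint n z) ω‖ < 1 / ((q : ℝ) + 1))
    (htr : Tendsto (fun n => truncMean M₀ M (truncRadius n) n ω) atTop (𝓝 0))
    (θ : EuclideanSpace ℝ (Fin d)) :
    Tendsto (fun n : ℕ => normCharFun M₀ M n ((√(Real.log n))⁻¹ • θ) ω
      * Complex.exp (-((Real.log n * inner ℝ (∫ x, x ∂ρ) ((√(Real.log n))⁻¹ • θ) : ℝ)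
        * Complex.I))) atTop
      (𝓝 (Complex.exp (-((∫ x, inner ℝ x θ ^ 2 ∂ρ : ℝ) : ℂ) / 2))) := by
  have ha := tendsto_log_natCast
  have hsq : Tendsto (fun n : ℕ => √(Real.log n)) atTop atTop := Real.tendsto_sqrt_atTop.comp ha
  have hc : (0 : ℝ) < M₀.mass := by exact_mod_cast hM₀
  set s : ℕ → EuclideanSpace ℝ (Fin d) := fun n => (√(Real.log n))⁻¹ • θ with hs
  set t : ℕ → EuclideanSpace ℝ (Fin d) := fun n => latticePoint n (latticeRound n (s n)) with ht
  have hst : ∀ n, ‖s n - t n‖ ≤ d / (n + 1) := fun n => norm_sub_latticePoint_le n (s n)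
  -- Rounding must be negligible even after multiplication by `log n`, since the centring phase is
  -- `log n ⟨m, s⟩`.
  have hast : Tendsto (fun n : ℕ => Real.log n * ‖s n - t n‖) atTop (𝓝 0) := by
    refine squeeze_zero' ?_ ?_ (tendsto_log_mul_div (d := d))
    · filter_upwards [ha.eventually_ge_atTop 0] with n hn
      positivity
    · filter_upwards [ha.eventually_ge_atTop 0] with n hn
      exact mul_le_mul_of_nonneg_left (hst n) hn
  have hss : ∀ᶠ n : ℕ in atTop, √(Real.log n) • s n = θ := by
    filter_upwards [hsq.eventually_gt_atTop 0] with n hn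
    simp only [hs]
    rw [smul_smul, mul_inv_cancel₀ hn.ne', one_smul]
  have htt : Tendsto (fun n : ℕ => √(Real.log n) • t n) atTop (𝓝 θ) := by
    have h1 : Tendsto (fun n : ℕ => √(Real.log n) • (s n - t n)) atTop (𝓝 0) := by
      refine squeeze_zero_norm' ?_ hast
      filter_upwards [ha.eventually_ge_atTop 1] with n hn
      rw [norm_smul, Real.norm_of_nonneg (Real.sqrt_nonneg _)]
      gcongr
      rw [Real.sqrt_le_iff]
      exact ⟨by linarith, by nlinarith⟩
    have h2 := (tendsto_const_nhds (x := θ)).sub h1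
    rw [sub_zero] at h2
    refine h2.congr' ?_
    filter_upwards [hss] with n hn
    rw [smul_sub, hn, sub_sub_cancel]
  have hs1 : ∀ᶠ n in atTop, ‖s n‖ ≤ 1 := by
    have h1 : Tendsto s atTop (𝓝 0) := by
      simpa using hsq.inv_tendsto_atTop.smul_const θ
    have h2 := h1.norm
    rw [norm_zero] at h2
    exact h2.eventually_le_const one_pos
  set Q : ℕ → ℂ := fun n => meanFactor M₀.mass (charFun ρ (t n)) (logTime n) n with hQ
  set u : ℕ → ℂ := fun n =>
    Complex.exp (-((Real.log n * inner ℝ (∫ x, x ∂ρ) (s n) : ℝ) * Complex.I)) with hu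
  set v : ℕ → ℂ := fun n =>
    Complex.exp (-((Real.log n * inner ℝ (∫ x, x ∂ρ) (t n) : ℝ) * Complex.I)) with hv
  have hu1 : ∀ n, ‖u n‖ = 1 := by
    intro n
    simp only [hu]
    rw [← neg_mul, ← Complex.ofReal_neg, Complex.norm_exp_ofReal_mul_I]
  have hQv : Tendsto (fun n => Q n * v n) atTop
      (𝓝 (Complex.exp (-((∫ x, inner ℝ x θ ^ 2 ∂ρ : ℝ) : ℂ) / 2))) :=
    tendsto_meanFactor_charFun hρ hρ1 hc htt
  have huv : Tendsto (fun n : ℕ => Complex.exp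
      (-((Real.log n * inner ℝ (∫ x, x ∂ρ) (s n - t n) : ℝ) * Complex.I))) atTop (𝓝 1) := by
    have h1 : Tendsto (fun n : ℕ => Real.log n * inner ℝ (∫ x, x ∂ρ) (s n - t n)) atTop (𝓝 0) := by
      have h2 := hast.const_mul ‖∫ x, x ∂ρ‖
      rw [mul_zero] at h2
      refine squeeze_zero_norm' ?_ h2
      filter_upwards [ha.eventually_ge_atTop 0] with n hn
      rw [norm_mul, Real.norm_of_nonneg hn, mul_left_comm]
      gcongr
      exact abs_real_inner_le_norm _ _
    have h2 : Continuous fun x : ℝ => Complex.exp (-((x : ℂ) * Complex.I)) := by fun_prop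
    have h3 := (h2.tendsto 0).comp h1
    simpa [Function.comp_def] using h3
  have hYN : Tendsto (fun n => normCharFun M₀ M (logTime n) (t n) ω) atTop (𝓝 1) := by
    have h1 := (htr.comp tendsto_logTime).const_mul (2 + (‖θ‖ + 1) * 2)
    rw [mul_zero] at h1
    rw [tendsto_iff_norm_sub_tendsto_zero]
    refine squeeze_zero' (.of_forall fun n => norm_nonneg _) ?_ h1
    have hb : ∀ᶠ n : ℕ in atTop, ‖√(Real.log n) • t n‖ ≤ ‖θ‖ + 1 :=
      htt.norm.eventually_le_const (by linarith)
    filter_upwards [hb, ha.eventually_ge_atTop 1] with n hn hn1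
    rw [← normCharFun_zero h hM₀ (logTime n) ω]
    refine (norm_normCharFun_sub_le hM₀ (truncRadius_pos (logTime n)) _ _ _ _).trans ?_
    refine mul_le_mul_of_nonneg_right ?_ (truncMean_nonneg (truncRadius_pos _) _ _)
    rw [sub_zero]
    -- The frequency `t n` is `O(1 / √(log n))`, while the radius at time `logTime n` is `O(√(log
    -- n))`.
    have h2 : ‖t n‖ * truncRadius (logTime n) ≤ (‖θ‖ + 1) * 2 := by
      calc _ ≤ ‖t n‖ * (2 * √(Real.log n)) := by gcongr; exact truncRadius_logTime_le hn1
        _ = ‖√(Real.log n) • t n‖ * 2 := by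
            rw [norm_smul, Real.norm_of_nonneg (Real.sqrt_nonneg _)]; ring
        _ ≤ _ := by gcongr
    linarith
  have hYst : Tendsto (fun n => (normCharFun M₀ M n (s n) ω - normCharFun M₀ M n (t n) ω) * u n)
      atTop (𝓝 0) := by
    have h1 := htr.const_mul (2 + (d : ℝ))
    rw [mul_zero] at h1
    refine squeeze_zero_norm (fun n => ?_) h1
    rw [norm_mul, hu1, mul_one]
    refine (norm_normCharFun_sub_le hM₀ (truncRadius_pos n) _ _ _ _).trans ?_
    refine mul_le_mul_of_nonneg_right ?_ (truncMean_nonneg (truncRadius_pos _) _ _)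
    have hn : (0 : ℝ) < n + 1 := by positivity
    have h2 : ‖s n - t n‖ * truncRadius n ≤ d / (n + 1) * (n + 1) :=
      mul_le_mul (hst n) (truncRadius_le n) (truncRadius_pos n).le (by positivity)
    rw [div_mul_cancel₀ _ hn.ne'] at h2
    linarith
  have hYt : Tendsto (fun n => (normCharFun M₀ M n (t n) ω
      - Q n * normCharFun M₀ M (logTime n) (t n) ω) * u n) atTop (𝓝 0) := by
    rw [Metric.tendsto_atTop']
    intro ε hε
    obtain ⟨q, hq⟩ := exists_nat_one_div_lt hε
    obtain ⟨K, hK⟩ := eventually_atTop.1 ((hlat q).and hs1)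
    refine ⟨K, fun n hn => ?_⟩
    obtain ⟨h1, h2⟩ := hK n hn.le
    rw [dist_zero_right, norm_mul, hu1, mul_one]
    exact (h1 _ (latticeRound_mem h2)).trans hq
  have key := (hYst.add hYt).add ((hQv.mul huv).mul hYN)
  rw [add_zero, zero_add, mul_one, mul_one] at key
  refine key.congr fun n => ?_
  have hmul : v n * Complex.exp
      (-((Real.log n * inner ℝ (∫ x, x ∂ρ) (s n - t n) : ℝ) * Complex.I)) = u n := by
    simp only [hu, hv]
    rw [← Complex.exp_add, inner_sub_right]
    congr 1
    push_cast
    ring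
  rw [mul_assoc (Q n), hmul]
  ring

end limit

/-! ### Lévy's theorem, and the effect of rescaling and translation. -/

section levy

variable {E : Type*} [NormedAddCommGroup E] [InnerProductSpace ℝ E] [FiniteDimensional ℝ E]
  [MeasurableSpace E] [BorelSpace E]

/-- Lévy's convergence theorem for finite measures. -/
lemma MeasureTheory.FiniteMeasure.tendsto_of_tendsto_charFun {F : ℕ → FiniteMeasure E}
    {G : FiniteMeasure E} (hG : G ≠ 0)
    (h : ∀ θ : E, Tendsto (fun n => charFun (F n : Measure E) θ) atTop
      (𝓝 (charFun (G : Measure E) θ))) :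
    Tendsto F atTop (𝓝 G) := by
  have hreal : ∀ K : FiniteMeasure E, (K : Measure E).real Set.univ = K.mass := fun K => rfl
  -- The mass is the Fourier transform at `0`; this reduces the claim to the normalised probability
  -- measures.
  have hmass : Tendsto (fun n => (F n).mass) atTop (𝓝 G.mass) := by
    have h0 := h 0
    simp only [charFun_zero, hreal] at h0
    have h1 := (Complex.continuous_re.tendsto _).comp h0
    simp only [Function.comp_def, Complex.ofReal_re] at h1
    exact NNReal.tendsto_coe.1 h1
  have hGm : G.mass ≠ 0 := by rwa [ne_eq, FiniteMeasure.mass_zero_iff]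
  have hchar : ∀ K : FiniteMeasure E, K ≠ 0 → ∀ θ, charFun (K.normalize : Measure E) θ
      = ((K.mass : ℝ) : ℂ)⁻¹ * charFun (K : Measure E) θ := by
    intro K hK θ
    rw [FiniteMeasure.toMeasure_normalize_eq_of_nonzero _ hK, charFun_apply, charFun_apply]
    rw [show (K.mass⁻¹ • (K : Measure E)) = ((K.mass⁻¹ : ℝ≥0) : ℝ≥0∞) • (K : Measure E) from rfl,
      integral_smul_measure, ENNReal.coe_toReal, NNReal.coe_inv, Complex.real_smul,
      Complex.ofReal_inv]
  refine FiniteMeasure.tendsto_of_tendsto_normalize_testAgainstNN_of_tendsto_mass ?_ hmass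
  refine ProbabilityMeasure.tendsto_iff_tendsto_charFun.2 fun θ => ?_
  have h1 : Tendsto (fun n => (((F n).mass : ℝ) : ℂ)⁻¹) atTop (𝓝 ((G.mass : ℝ) : ℂ)⁻¹) := by
    refine Tendsto.inv₀ ((Complex.continuous_ofReal.tendsto _).comp
      (NNReal.tendsto_coe.2 hmass)) ?_
    rw [Complex.ofReal_ne_zero]
    exact_mod_cast hGm
  rw [hchar G hG θ]
  refine (h1.mul (h θ)).congr' ?_
  filter_upwards [hmass.eventually_ne hGm] with n hn
  rw [hchar (F n) (by rwa [ne_eq, ← FiniteMeasure.mass_zero_iff]) θ]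

lemma charFun_rescale (a : ℝ) (b : E) (K : FiniteMeasure E) (θ : E) :
    charFun (rescale a b K : Measure E) θ
      = charFun (K : Measure E) (a⁻¹ • θ)
        * Complex.exp (-((inner ℝ b (a⁻¹ • θ) : ℝ) * Complex.I)) := by
  rw [rescale, FiniteMeasure.toMeasure_map, charFun_apply, charFun_apply,
    integral_map (by fun_prop) (by fun_prop), ← integral_mul_const]
  refine integral_congr_ae (ae_of_all _ fun x => ?_)
  simp only
  rw [← Complex.exp_add, inner_smul_left, inner_sub_left, inner_smul_right, inner_smul_right]
  congr 1
  simp only [conj_trivial]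
  push_cast
  ring

omit [InnerProductSpace ℝ E] [FiniteDimensional ℝ E] in
-- By subadditivity of `t ↦ min 1 (t / r)`. This is the drift hypothesis of the truncation
-- estimates, with `L = E‖Δ‖`.
lemma integral_truncation_map_const_add_le {ρ : Measure E} [IsProbabilityMeasure ρ]
    (hρ1 : Integrable id ρ) {r : ℝ} (hr : 0 < r) (x : E) :
    ∫ y, min 1 (‖y‖ / r) ∂(ρ.map fun y => x + y) ≤ min 1 (‖x‖ / r) + (∫ y, ‖y‖ ∂ρ) / r := by
  rw [integral_map (by fun_prop) (by fun_prop : Measurable _).aestronglyMeasurable]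
  have hn : Integrable (fun y => ‖y‖ / r) ρ := hρ1.norm.div_const r
  have h1 : Integrable (fun y => min 1 (‖x‖ / r) + ‖y‖ / r) ρ :=
    (integrable_const _).add hn
  have h2 : ∫ y, (min 1 (‖x‖ / r) + ‖y‖ / r) ∂ρ = min 1 (‖x‖ / r) + (∫ y, ‖y‖ ∂ρ) / r := by
    rw [integral_add (integrable_const _) hn, integral_div]
    simp
  rw [← h2]
  refine integral_mono (.of_bound (C := 1) (by fun_prop : Measurable _).aestronglyMeasurable
    (ae_of_all _ fun y => norm_truncation_le hr _)) h1 fun y => ?_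
  have h3 : ‖x + y‖ / r ≤ ‖x‖ / r + ‖y‖ / r := by
    rw [← add_div]
    gcongr
    exact norm_add_le _ _
  have h4 : 0 ≤ ‖y‖ / r := by positivity
  simp only
  rcases min_cases 1 (‖x‖ / r) with ⟨h, _⟩ | ⟨h, _⟩ <;> rw [h]
  · exact (min_le_left _ _).trans (by linarith)
  · exact (min_le_right _ _).trans h3

end levy

/-! ### Moments of the increment and the limiting covariance matrix. -/

section moments

variable {d : ℕ} {Ω' : Type*} [MeasurableSpace Ω'] {ν : Measure Ω'}
  {Δ : Ω' → EuclideanSpace ℝ (Fin d)}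

/-- Restricting to `θ = t e_i` makes the moment generating function of each coordinate finite near
`0`. Exponential moments enter the proof only here; everything else uses second moments. -/
lemma memLp_coord_of_integrable_exp
    (hexp : ∃ r : ℝ, 0 < r ∧ ∀ θ ∈ Metric.closedBall (0 : EuclideanSpace ℝ (Fin d)) r,
      Integrable (fun ω => Real.exp (inner ℝ θ (Δ ω))) ν) (i : Fin d) :
    MemLp (fun ω => Δ ω i) 2 ν := by
  obtain ⟨r, hr, hθ⟩ := hexp
  refine memLp_of_mem_interior_integrableExpSet (p := 2) (mem_interior_iff_mem_nhds.2 ?_)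
  filter_upwards [Metric.closedBall_mem_nhds (0 : ℝ) hr] with t ht
  have h1 := hθ (EuclideanSpace.single i t) (by
    rw [mem_closedBall_zero_iff] at ht ⊢
    simpa using ht)
  change Integrable _ ν
  refine h1.congr (ae_of_all _ fun ω => ?_)
  simp [EuclideanSpace.inner_single_left]

lemma memLp_of_memLp_coord (hΔ : AEMeasurable Δ ν) (h : ∀ i, MemLp (fun ω => Δ ω i) 2 ν) :
    MemLp Δ 2 ν := by
  rw [memLp_two_iff_integrable_sq_norm hΔ.aestronglyMeasurable]
  have h1 : Integrable (fun ω => ∑ i, Δ ω i ^ 2) ν :=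
    integrable_finsetSum _ fun i _ => (h i).integrable_sq
  refine h1.congr (ae_of_all _ fun ω => ?_)
  simp only [EuclideanSpace.norm_sq_eq, Real.norm_eq_abs, sq_abs]

/-- The second moment matrix of `Δ` represents the quadratic form `θ ↦ E ⟨Δ, θ⟩²`. -/
lemma dotProduct_covMat_add_outerSq_mulVec [IsProbabilityMeasure ν]
    (h : ∀ i, MemLp (fun ω => Δ ω i) 2 ν) (hint : Integrable Δ ν) (x : Fin d → ℝ) :
    x ⬝ᵥ ((covMat Δ ν + outerSq (∫ ω, Δ ω ∂ν)).mulVec x)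
      = ∫ ω, (∑ i, x i * Δ ω i) ^ 2 ∂ν := by
  have hentry : ∀ i j, (covMat Δ ν + outerSq (∫ ω, Δ ω ∂ν)) i j = ∫ ω, Δ ω i * Δ ω j ∂ν := by
    intro i j
    have hi : ∀ i, (∫ ω, Δ ω ∂ν) i = ∫ ω, Δ ω i ∂ν := fun i =>
      ((EuclideanSpace.proj (𝕜 := ℝ) i).integral_comp_comm hint).symm
    rw [Matrix.add_apply, covMat, outerSq, Matrix.of_apply, Matrix.of_apply,
      covariance_eq_sub (h i) (h j), hi, hi]
    simp
  have hprod : ∀ i j, Integrable (fun ω => Δ ω i * Δ ω j) ν := fun i j =>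
    (h i).integrable_mul (h j)
  simp only [dotProduct, Matrix.mulVec, hentry]
  have h1 : ∀ ω, (∑ i, x i * Δ ω i) ^ 2 = ∑ i, ∑ j, x i * (x j * (Δ ω i * Δ ω j)) := by
    intro ω
    rw [sq, Finset.sum_mul_sum]
    refine Finset.sum_congr rfl fun i _ => Finset.sum_congr rfl fun j _ => ?_
    ring
  simp only [h1]
  rw [integral_finsetSum _ fun i _ => integrable_finsetSum _ fun j _ =>
    ((hprod i j).const_mul _).const_mul _]
  refine Finset.sum_congr rfl fun i _ => ?_
  rw [integral_finsetSum _ fun j _ => ((hprod i j).const_mul _).const_mul _, Finset.mul_sum]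
  refine Finset.sum_congr rfl fun j _ => ?_
  rw [integral_const_mul, integral_const_mul]
  ring

/-- The quadratic form is a second moment, hence non-negative. The formula for the characteristic
function of `multivariateGaussian` requires this. -/
lemma posSemidef_covMat_add_outerSq [IsProbabilityMeasure ν]
    (h : ∀ i, MemLp (fun ω => Δ ω i) 2 ν) (hint : Integrable Δ ν) :
    (covMat Δ ν + outerSq (∫ ω, Δ ω ∂ν)).PosSemidef := by
  refine .of_dotProduct_mulVec_nonneg ?_ fun x => ?_
  · ext i j
    simp [covMat, outerSq, covariance_comm (fun ω => Δ ω i), mul_comm]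
  · rw [star_trivial, dotProduct_covMat_add_outerSq_mulVec h hint]
    exact integral_nonneg fun ω => sq_nonneg _

end moments

/-! ### Assembly of the theorem. -/

theorem theorem2 {d : ℕ}
    -- the increment `Δ`, a random vector of `ℝ^d` with exponential moments near `0`
    {Ω' : Type*} [MeasurableSpace Ω'] (ν : Measure Ω') [IsProbabilityMeasure ν]
    (Δ : Ω' → EuclideanSpace ℝ (Fin d)) (hΔ : AEMeasurable Δ ν)
    (hexp : ∃ r : ℝ, 0 < r ∧ ∀ θ ∈ Metric.closedBall (0 : EuclideanSpace ℝ (Fin d)) r,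
      Integrable (fun ω => Real.exp (inner ℝ θ (Δ ω))) ν)
    -- `R x` is the law of `x + Δ`
    (R : Kernel (EuclideanSpace ℝ (Fin d)) (EuclideanSpace ℝ (Fin d)))
    (hR : ∀ x, R x = ν.map (fun ω => x + Δ ω))
    -- mean and covariance of `Δ`
    (m : EuclideanSpace ℝ (Fin d)) (hm : m = ∫ ω, Δ ω ∂ν)
    (Sigma2 : Matrix (Fin d) (Fin d) ℝ) (hSigma2 : Sigma2 = covMat Δ ν)
    -- the initial composition and the process
    (M₀ : FiniteMeasure (EuclideanSpace ℝ (Fin d))) (hM₀ : 0 < M₀.mass)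
    {Ω : Type*} [MeasurableSpace Ω] (μ : Measure Ω) [IsProbabilityMeasure μ]
    (M : ℕ → Ω → FiniteMeasure (EuclideanSpace ℝ (Fin d)))
    (hM : IsMVPP μ M₀ R M) :
    ∀ᵐ ω ∂μ, Tendsto
      (fun n : ℕ => rescale (Real.sqrt (Real.log n)) (Real.log n • m) ((n : ℝ≥0)⁻¹ • M n ω))
      atTop (𝓝 (gaussianLaw 0 (Sigma2 + outerSq m))) := by
  obtain ⟨ℱ, C, hC, h0, hsucc, hlaw⟩ := hM
  have h : IsPolyaScheme μ M₀ R M ℱ C := ⟨hC, h0, hsucc, hlaw⟩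
  subst hm hSigma2
  set m : EuclideanSpace ℝ (Fin d) := ∫ ω, Δ ω ∂ν with hm
  have hcoord := memLp_coord_of_integrable_exp hexp
  have hL2 := memLp_of_memLp_coord hΔ hcoord
  have hint : Integrable Δ ν := hL2.integrable one_le_two
  set ρ : Measure (EuclideanSpace ℝ (Fin d)) := ν.map Δ with hρdef
  have : IsProbabilityMeasure ρ := Measure.isProbabilityMeasure_map hΔ
  have hρ1 : Integrable id ρ := (integrable_map_measure aestronglyMeasurable_id hΔ).2 hint
  have hρ : Integrable (fun x => ‖x‖ ^ 2) ρ :=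
    (integrable_map_measure (by fun_prop : Continuous _).aestronglyMeasurable hΔ).2
      ((memLp_two_iff_integrable_sq_norm hΔ.aestronglyMeasurable).1 hL2)
  have hρm : ∫ x, x ∂ρ = m := integral_map hΔ aestronglyMeasurable_id
  have hRρ : ∀ x, R x = ρ.map fun y => x + y := by
    intro x
    rw [hR, hρdef, AEMeasurable.map_map_of_aemeasurable (by fun_prop) hΔ]
    rfl
  have : IsMarkovKernel R := ⟨fun x => by
    rw [hRρ]; exact Measure.isProbabilityMeasure_map (by fun_prop)⟩
  have hw : ∀ s x, charFun (R x) s = Complex.exp (inner ℝ x s * Complex.I) * charFun ρ s := by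
    intro s x
    rw [hRρ, charFun_map_const_add, mul_comm]
  have hw1 : ∀ s, ‖charFun ρ s‖ ≤ 1 := fun s => norm_charFun_le_one s
  have hlat : ∀ᵐ ω ∂μ, ∀ q : ℕ, ∀ᶠ n in atTop, ∀ z ∈ latticeCube d n,
      ‖normCharFun M₀ M n (latticePoint n z) ω
        - meanFactor M₀.mass (charFun ρ (latticePoint n z)) (logTime n) n
          * normCharFun M₀ M (logTime n) (latticePoint n z) ω‖ < 1 / ((q : ℝ) + 1) :=
    ae_all_iff.2 fun q => h.ae_eventually_lattice hM₀ hw hw1 (by positivity)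
  have htr := h.ae_tendsto_truncMean hM₀ (integral_nonneg fun y => norm_nonneg y)
    (fun r hr x => (hRρ x) ▸ integral_truncation_map_const_add_le hρ1 hr x) truncRadius_pos
    truncRadius_mono tendsto_truncRadius summable_truncRadius tendsto_harmonic_div_truncRadius
  filter_upwards [hlat, htr] with ω h1 h2
  refine FiniteMeasure.tendsto_of_tendsto_charFun ?_ fun θ => ?_
  · rw [ne_eq, ← FiniteMeasure.mass_zero_iff]
    have : (gaussianLaw 0 (covMat Δ ν + outerSq m)).mass = 1 := by
      rw [← ENNReal.coe_inj, FiniteMeasure.ennreal_mass]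
      exact measure_univ (μ := multivariateGaussian 0 (covMat Δ ν + outerSq m))
    rw [this]
    exact one_ne_zero
  · have hlim := h.tendsto_normCharFun hM₀ hρ hρ1 h1 h2 θ
    have hgauss : charFun (gaussianLaw 0 (covMat Δ ν + outerSq m)
        : Measure (EuclideanSpace ℝ (Fin d))) θ
        = Complex.exp (-((∫ x, inner ℝ x θ ^ 2 ∂ρ : ℝ) : ℂ) / 2) := by
      change charFun (multivariateGaussian 0 (covMat Δ ν + outerSq m)) θ = _
      rw [charFun_multivariateGaussian (posSemidef_covMat_add_outerSq hcoord hint),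
        dotProduct_covMat_add_outerSq_mulVec hcoord hint, hρdef,
        integral_map hΔ (by fun_prop : Continuous _).aestronglyMeasurable]
      simp [PiLp.inner_apply, neg_div]
    rw [hgauss]
    -- The theorem divides by `n`, the Fourier estimates by the true mass `n + c`; the ratio tends
    -- to `1`.
    have hn : Tendsto (fun n : ℕ => (((n + M₀.mass : ℝ) / n : ℝ) : ℂ)) atTop (𝓝 1) := by
      have h3 : Tendsto (fun n : ℕ => 1 + (M₀.mass : ℝ) / n) atTop (𝓝 1) := by
        simpa using (tendsto_const_nhds (x := (1 : ℝ))).add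
          (tendsto_natCast_atTop_atTop.const_div_atTop (M₀.mass : ℝ))
      have h4 := (Complex.continuous_ofReal.tendsto _).comp h3
      rw [Complex.ofReal_one] at h4
      refine h4.congr' ?_
      filter_upwards [eventually_gt_atTop 0] with n hn
      have : (n : ℝ) ≠ 0 := by exact_mod_cast hn.ne'
      simp only [Function.comp_apply]
      congr 1
      field_simp
    have hfin := hn.mul hlim
    rw [one_mul] at hfin
    refine hfin.congr' ?_
    filter_upwards [eventually_gt_atTop 0] with n hn0
    have hn1 : (n : ℂ) ≠ 0 := by exact_mod_cast hn0.ne'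
    have hn2 : (((n : ℝ) + M₀.mass : ℝ) : ℂ) ≠ 0 := by
      rw [Complex.ofReal_ne_zero]; positivity
    have hsm : charFun (((n : ℝ≥0)⁻¹ • M n ω : FiniteMeasure (EuclideanSpace ℝ (Fin d)))
        : Measure (EuclideanSpace ℝ (Fin d))) ((√(Real.log n))⁻¹ • θ)
        = (n : ℂ)⁻¹ * charFun (M n ω : Measure (EuclideanSpace ℝ (Fin d)))
          ((√(Real.log n))⁻¹ • θ) := by
      rw [FiniteMeasure.toMeasure_smul, charFun_apply, charFun_apply,
        show ((n : ℝ≥0)⁻¹ • (M n ω : Measure (EuclideanSpace ℝ (Fin d))))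
          = (((n : ℝ≥0)⁻¹ : ℝ≥0) : ℝ≥0∞) • (M n ω : Measure (EuclideanSpace ℝ (Fin d))) from rfl,
        integral_smul_measure, ENNReal.coe_toReal, NNReal.coe_inv, Complex.real_smul,
        Complex.ofReal_inv]
      simp
    rw [charFun_rescale, hsm, normCharFun, hρm, real_inner_smul_left, Complex.ofReal_div,
      Complex.ofReal_natCast]
    field_simp
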